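/- Two players, 1 and 2, alternate forever in choosing between a safe arm $S$ and a risky arm $R$; player 1 moves first, and a period consists of one choice of each player. The safe arm pays $0$. The risky arm has a type $\theta\in\{G,B\}$, drawn once and for all, with common prior $p_0=\mathbf P(\theta=G)$; each use of it costs $c>0$, and it pays $m$ with probability $\lambda\in(0,1)$ and $0$ otherwise (independently across uses) if $\theta=G$, and always $0$ if $\theta=B$. Choices are public, payoffs are private. Players maximize their expected discounted payoffs, with discount factor $\delta\in(0,1)$ between periods, and $g:=\lambda m-c>0$. An experiment (a choice of $R$) is successful if it pays $m$. Let $$\phi(p)=\frac{p(1-\lambda)}{p(1-\lambda)+1-p},\qquad p^*=\frac{c(1-\delta)}{c(1-\delta)+g(1-\delta(1-\lambda))},$$ $$p^*_1=\frac{c(1-\delta)}{c(1-\delta)+g\bigl(1-\delta+\delta\lambda(1-\lambda)\bigr)},\qquad \widehat p=\frac{c(1-\delta)}{c(1-\delta)+g\bigl(1-\delta+\lambda\delta(1+\delta-\lambda\delta)\bigr)},$$ and let $\phi^{-1}$ be the inverse of the bijection $\phi:[0,1]\to[0,1]$. A sequential equilibrium (SE) is a pair $(\sigma,\pi)$ of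 a profile of behaviour strategies (defined at all private histories) and a belief system, which assigns to each private history of each player a probability distribution on the full histories consistent with it, such that $\sigma$ is sequentially rational given $\pi$ at each private history, and $(\sigma,\pi)$ is the pointwise limit of completely mixed profiles and the beliefs that they induce by Bayes' rule. For a public history $h$ (a finite sequence of choices), let $n_{\mathrm e}(h)$ be the number of $R$'s in $h$, and $p^i(h)$ the probability that player $i$ assigns under $\pi$ to $\theta=G$ when the choices were $h$ and his own experiments along $h$ all failed. The SE is *reasonable* if for each public history $h'$, with active player $i$: (1) if $h'=hS$, then $p^i(h')=\phi^{n_{\mathrm e}(h)}(p_0)$; (2) if $h'=hSaR$ with $a\in\{S,R\}$, then $p^i(h')=\phi^{n_{\mathrm e}(hSa)}(p_0)$. It is *pure* if $\sigma$ does not randomize at any private history. **Proposition.** If $\phi^{-1}(\widehat p)<p^*$ and $p_0\in(\phi^{-1}(\widehat p),p^*_1)$, then there is no pure reasonable SE. -/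

import Mathlib

namespace Bandit

noncomputable section

/-! ### Primitives -/

/-- The parameters of the game: success probability of the good risky arm, discount factor
between periods, opportunity cost of the risky arm, size of a success, and common prior
probability that the risky arm is good. The restrictions on them are stated in the theorem. -/
structure Game where
  lam : ℝ
  δ : ℝ
  c : ℝ
  m : ℝ
  p0 : ℝ

/-- The expected net flow payoff of the risky arm when it is good. -/
def Game.g (Γ : Game) : ℝ := Γ.lam * Γ.m - Γ.c

/-- The two players. -/
inductive Player
  | one
  | two
  deriving DecidableEq

/-- The two arms: safe and risky. -/
inductive Arm
  | S
  | R
  deriving DecidableEq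

/-- The type of the risky arm: good or bad. -/
inductive State
  | G
  | B
  deriving DecidableEq

instance : Fintype State := ⟨{.G, .B}, fun x => by cases x <;> simp⟩

/-- One move together with its outcome: the safe arm, a failed experiment, or a successful
experiment. -/
inductive Event
  | safe
  | fail
  | success
  deriving DecidableEq

instance : Fintype Event := ⟨{.safe, .fail, .success}, fun x => by cases x <;> simp⟩

/-- The publicly observed part of an event. -/
def Event.arm : Event → Arm
  | .safe => .S
  | .fail => .R
  | .success => .R

/-- The net payoff of an event to the player who made the move. -/
def Game.reward (Γ : Game) : Event → ℝ
  | .safe => 0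
  | .fail => -Γ.c
  | .success => Γ.m - Γ.c

/-- The player who moves after `n` moves: the players alternate, player 1 first. -/
def mover (n : ℕ) : Player := if Even n then .one else .two

/-! ### Histories

All histories are lists with the MOST RECENT move at the head. A public history is a `List Arm`.
The sequence of all moves and outcomes is a `List Event`; a full history is such a list together
with a state. A private history of a player is a `List Signal`. -/

/-- What a player observes of one move: the move and its outcome if it is his own, and only the
arm if it is the other player's. -/
inductive Signal
  | own (e : Event)
  | other (a : Arm)
  deriving DecidableEq

/-- The private history of player `i` along a sequence of moves and outcomes. -/
def view (i : Player) : List Event → List Signal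
  | [] => []
  | e :: f => (if mover f.length = i then Signal.own e else Signal.other e.arm) :: view i f

/-- The set of all sequences of `n` moves and outcomes. -/
def histories : ℕ → Finset (List Event)
  | 0 => {[]}
  | n + 1 => (histories n).biUnion fun f => Finset.univ.image fun e => e :: f

theorem mem_histories (n : ℕ) (f : List Event) : f ∈ histories n ↔ f.length = n := by
  induction n generalizing f with
  | zero => simp [histories]
  | succ n ih =>
    cases f with
    | nil => simp [histories]
    | cons e f => simp [histories, ih]

/-- The sequences of moves and outcomes that are consistent with the private history `s` of
player `i`. -/
def consistentWith (i : Player) (s : List Signal) : Finset (List Event) :=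
  (histories s.length).filter fun f => view i f = s

/-- The sequence of moves and outcomes in which all experiments along the public history fail. -/
def allFail : List Arm → List Event
  | [] => []
  | .S :: h => .safe :: allFail h
  | .R :: h => .fail :: allFail h

/-- The number of experiments along a public history. -/
def numExp (h : List Arm) : ℕ := h.count Arm.R

/-! ### Strategies and the probabilities that they induce -/

/-- A (behaviour) strategy: the probability of choosing the risky arm at each private history.
Only the values at private histories at which the player is active play a role. -/
abbrev Strategy := List Signal → unitInterval

/-- A strategy profile. -/
abbrev Profile := Player → Strategy

/-- The probability that an experiment is successful. -/
def Game.succProb (Γ : Game) : State → ℝ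
  | .G => Γ.lam
  | .B => 0

/-- The common prior. -/
def Game.prior (Γ : Game) : State → ℝ
  | .G => Γ.p0
  | .B => 1 - Γ.p0

/-- The probability that the next move and its outcome are `e`, after `f`, in state `θ`. -/
def Game.moveProb (Γ : Game) (σ : Profile) (θ : State) (f : List Event) : Event → ℝ
  | .safe => 1 - (σ (mover f.length) (view (mover f.length) f) : ℝ)
  | .fail => (σ (mover f.length) (view (mover f.length) f) : ℝ) * (1 - Γ.succProb θ)
  | .success => (σ (mover f.length) (view (mover f.length) f) : ℝ) * Γ.succProb θ

/-- The probability that the play starts with `f`, in state `θ`. -/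
def Game.pathProb (Γ : Game) (σ : Profile) (θ : State) : List Event → ℝ
  | [] => 1
  | e :: f => Γ.pathProb σ θ f * Γ.moveProb σ θ f e

/-! ### Beliefs -/

/-- Weights `π i s θ f` that player `i` assigns at his private history `s` to the full history
`(θ, f)`. -/
abbrev Beliefs := Player → List Signal → State → List Event → ℝ

/-- `π` is a belief system: at each private history of each player it is a probability
distribution on the full histories consistent with that private history. -/
def IsBeliefSystem (π : Beliefs) : Prop :=
  ∀ (i : Player) (f : List Event),
    (∀ θ f', 0 ≤ π i (view i f) θ f') ∧
    (∀ θ f', view i f' ≠ view i f → π i (view i f) θ f' = 0) ∧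
    ∑ θ : State, ∑ f' ∈ consistentWith i (view i f), π i (view i f) θ f' = 1

/-- The beliefs deduced by Bayes' rule from the profile `τ`. -/
def Game.bayes (Γ : Game) (τ : Profile) : Beliefs := fun i s θ f =>
  if view i f = s then
    Γ.prior θ * Γ.pathProb τ θ f /
      ∑ θ' : State, ∑ f' ∈ consistentWith i s, Γ.prior θ' * Γ.pathProb τ θ' f'
  else 0

/-- Both arms are chosen with positive probability at each private history, even after a
success. -/
def CompletelyMixed (τ : Profile) : Prop :=
  ∀ f : List Event, 0 < (τ (mover f.length) (view (mover f.length) f) : ℝ) ∧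
    (τ (mover f.length) (view (mover f.length) f) : ℝ) < 1

/-- Consistency of beliefs in the sense of Kreps and Wilson: there are completely mixed profiles
that converge pointwise to `σ` and whose Bayesian beliefs converge pointwise to `π`. -/
def Game.Consistent (Γ : Game) (σ : Profile) (π : Beliefs) : Prop :=
  ∃ τ : ℕ → Profile, (∀ n, CompletelyMixed (τ n)) ∧
    (∀ f : List Event, Filter.Tendsto
      (fun n => (τ n (mover f.length) (view (mover f.length) f) : ℝ)) Filter.atTop
      (nhds (σ (mover f.length) (view (mover f.length) f) : ℝ))) ∧
    (∀ (i : Player) (f : List Event) (θ : State) (f' : List Event), Filter.Tendsto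
      (fun n => Γ.bayes (τ n) i (view i f) θ f') Filter.atTop
      (nhds (π i (view i f) θ f')))

/-- `p^i(h)`: the probability that `i` assigns to the risky arm being good, when the sequence of
choices is `h` and his own experiments along `h` all failed. -/
def firstOrderBelief (π : Beliefs) (i : Player) (h : List Arm) : ℝ :=
  ∑ f ∈ consistentWith i (view i (allFail h)), π i (view i (allFail h)) State.G f

/-! ### Payoffs and sequential rationality -/

/-- The expected reward of player `i` from the `k`-th move from now (`k = 0` is the move about to
be made), when `f` has been played and the state is `θ`. -/
def Game.expReward (Γ : Game) (σ : Profile) (θ : State) (i : Player) : ℕ → List Event → ℝ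
  | 0, f => if mover f.length = i then ∑ e : Event, Γ.moveProb σ θ f e * Γ.reward e else 0
  | k + 1, f => ∑ e : Event, Γ.moveProb σ θ f e * Γ.expReward σ θ i k (e :: f)

/-- The normalized expected discounted continuation payoff of player `i` at a full history at
which he is active. His next moves are the moves number `0, 2, 4, …` from now, one per period.
The series converges absolutely, since the expected rewards are bounded. -/
def Game.payoffAt (Γ : Game) (σ : Profile) (θ : State) (i : Player) (f : List Event) : ℝ :=
  (1 - Γ.δ) * ∑' t : ℕ, Γ.δ ^ t * Γ.expReward σ θ i (2 * t) f

/-- The continuation payoff of player `i` at his private history `s`, given his beliefs. -/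
def Game.contPayoff (Γ : Game) (π : Beliefs) (σ : Profile) (i : Player) (s : List Signal) : ℝ :=
  ∑ θ : State, ∑ f ∈ consistentWith i s, π i s θ f * Γ.payoffAt σ θ i f

/-- At each private history, on or off the path, the continuation strategy of the active player
is optimal among all his strategies, given his beliefs and the strategy of the other player. -/
def Game.SequentiallyRational (Γ : Game) (σ : Profile) (π : Beliefs) : Prop :=
  ∀ (f : List Event) (τ : Strategy),
    Γ.contPayoff π (Function.update σ (mover f.length) τ) (mover f.length)
        (view (mover f.length) f) ≤
      Γ.contPayoff π σ (mover f.length) (view (mover f.length) f)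

/-! ### Equilibrium -/

/-- The belief after a failed experiment, starting from the belief `p`. -/
def phi (lam p : ℝ) : ℝ := p * (1 - lam) / (p * (1 - lam) + 1 - p)

/-- Reasonable beliefs. If the other player has just chosen `S`, then all past experiments are
believed to have failed. If, moreover, after some move `a` of the active player the other player
now chooses `R`, this choice is not informative. -/
def Game.ReasonableBeliefs (Γ : Game) (π : Beliefs) : Prop :=
  (∀ h : List Arm,
    firstOrderBelief π (mover (Arm.S :: h).length) (Arm.S :: h) =
      (phi Γ.lam)^[numExp h] Γ.p0) ∧
  (∀ (h : List Arm) (a : Arm),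
    firstOrderBelief π (mover (Arm.R :: a :: Arm.S :: h).length) (Arm.R :: a :: Arm.S :: h) =
      (phi Γ.lam)^[numExp (a :: Arm.S :: h)] Γ.p0)

/-- Sequential equilibrium. -/
def Game.IsSequentialEquilibrium (Γ : Game) (σ : Profile) (π : Beliefs) : Prop :=
  IsBeliefSystem π ∧ Γ.SequentiallyRational σ π ∧ Γ.Consistent σ π

/-- Reasonable sequential equilibrium. -/
def Game.IsReasonableSE (Γ : Game) (σ : Profile) (π : Beliefs) : Prop :=
  Γ.IsSequentialEquilibrium σ π ∧ Γ.ReasonableBeliefs π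

/-- The profile does not randomize at any private history. -/
def IsPure (σ : Profile) : Prop :=
  ∀ f : List Event, σ (mover f.length) (view (mover f.length) f) = 0 ∨
    σ (mover f.length) (view (mover f.length) f) = 1

/-! ### Cut-offs -/

/-- The one-player cut-off `p^*`. -/
def Game.pStar (Γ : Game) : ℝ :=
  Γ.c * (1 - Γ.δ) / (Γ.c * (1 - Γ.δ) + Γ.g * (1 - Γ.δ * (1 - Γ.lam)))

/-- The cut-offs `p^*_n`. -/
def Game.pStarN (Γ : Game) (n : ℕ) : ℝ :=
  Γ.c * (1 - Γ.δ) /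
    (Γ.c * (1 - Γ.δ) + Γ.g * (1 - Γ.δ + Γ.δ * Γ.lam * (1 - Γ.lam) ^ n))

/-- The encouragement cut-off. -/
def Game.pHat (Γ : Game) : ℝ :=
  Γ.c * (1 - Γ.δ) /
    (Γ.c * (1 - Γ.δ) +
      Γ.g * (1 - Γ.δ + Γ.lam * Γ.δ * (1 + Γ.δ - Γ.lam * Γ.δ)))

/-- The inverse of `phi lam` on `[0, 1]`. -/
def phiInv (lam q : ℝ) : ℝ := q / (q + (1 - q) * (1 - lam))

theorem phiInv_mem {lam q : ℝ} (h1 : lam < 1) (hq : q ∈ Set.Icc (0 : ℝ) 1) :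
    phiInv lam q ∈ Set.Icc (0 : ℝ) 1 := by
  obtain ⟨hq0, hq1⟩ := hq
  have h : 0 ≤ (1 - q) * (1 - lam) := mul_nonneg (by linarith) (by linarith)
  exact ⟨div_nonneg hq0 (by linarith), div_le_one_of_le₀ (by linarith) (by linarith)⟩

theorem phi_phiInv {lam q : ℝ} (h1 : lam < 1) (hq : q ∈ Set.Icc (0 : ℝ) 1) :
    phi lam (phiInv lam q) = q := by
  obtain ⟨hq0, hq1⟩ := hq
  have hl : 0 < 1 - lam := by linarith
  have hd : 0 < q + (1 - q) * (1 - lam) := by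
    rcases hq0.eq_or_lt with h | h
    · subst h; simpa using hl
    · nlinarith
  have e : q / (q + (1 - q) * (1 - lam)) * (1 - lam) + 1 - q / (q + (1 - q) * (1 - lam))
      = (1 - lam) / (q + (1 - q) * (1 - lam)) := by
    field_simp
    ring
  unfold phi phiInv
  rw [e]
  field_simp

theorem phiInv_phi {lam p : ℝ} (h1 : lam < 1) (hp : p ∈ Set.Icc (0 : ℝ) 1) :
    phiInv lam (phi lam p) = p := by
  obtain ⟨hp0, hp1⟩ := hp
  have hl : 0 < 1 - lam := by linarith
  have hd : 0 < p * (1 - lam) + 1 - p := by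
    rcases hp1.eq_or_lt with h | h
    · subst h; linarith
    · nlinarith
  have e : p * (1 - lam) / (p * (1 - lam) + 1 - p) +
      (1 - p * (1 - lam) / (p * (1 - lam) + 1 - p)) * (1 - lam)
      = (1 - lam) / (p * (1 - lam) + 1 - p) := by
    field_simp
    ring
  unfold phi phiInv
  rw [e]
  field_simp

end

end Bandit

namespace Bandit

noncomputable section

/-! ### The reduced game

In a pure reasonable equilibrium a player who has had a success always experiments, so that only
the choices, beliefs and values of players without a success matter. They are functions of the
public history. -/

/-! A player who has had a success knows that the arm is good and strictly prefers `R`. So only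
players without a success have a choice to make, and in a pure equilibrium it is a function of the
public history. If an unsuccessful opponent would choose `R`, his `R` carries no news (pooling); if
he would choose `S`, his choice shows whether he has had a success (separation). In the bad state
only failures occur, so after division by the probability of the bad state all transition
probabilities cancel and the Bellman equations are linear in the odds. This is `Reduced`, obtained
from an equilibrium in `reduced`.

In terms of odds, with `K = (1 - δ) c / g`, the cut-offs `p̂`, `p*`, `p*_1` are `K / A`, `K / (1 - δ
+ δλ)`, `K / (1 - δ + δλ(1 - λ))`, where `A = 1 - δ + δλ + δ²λ(1 - λ)`. The last term of `A` is the
gain from encouragement: after an own failure, the other player experiments in reply and later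
reveals his result.

Let `r_n = r0 (1 - λ)^n`, and let `N` be the least `n` with `r_n ≤ K / A`; the bounds on the prior
give `N ≥ 2`. Backward induction on the number of experiments shows that after `S` nobody
experiments once there have been more than `N` of them (`stopAfter_of_lt`).

After `N - 2` experiments, let the choices be `S, S, R, S`, and let `j` be the player who chose `R`
and failed. His odds are `r_(N-1)`, between `p̂` and `p*`: a second experiment pays if and only if
it is encouraged. If he stops here, then `R` would be read as a success and answered by `R`, so
deviating to `R` pays. If he chooses `R`, this is no news, the other player has odds `r_(N-2)`,
below `p*_1`, and prefers to wait for `j` to reveal his results (`act_eq_safe_of_revealing`), so `R`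
does not pay. Both cases are impossible (`false_of_odds`). -/

@[simp] theorem numExp_nil : numExp [] = 0 := rfl

@[simp] theorem numExp_safe (h : List Arm) : numExp (Arm.S :: h) = numExp h := by
  simp [numExp]

@[simp] theorem numExp_risky (h : List Arm) : numExp (Arm.R :: h) = numExp h + 1 := by
  simp [numExp]

/-- The equilibrium data of the active player when his own experiments have failed. Here `good h`
says that the bad state is not excluded, `odds h` are the odds of the good state, and `val h` is
the continuation value, normalized by `g` and by the probability of the bad state. The constants
are the success probability, the discount factor, `K = (1 - δ) c / g` and the prior odds. -/
structure Reduced (lam δ K r0 : ℝ) where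
  act : List Arm → Arm
  good : List Arm → Prop
  odds : List Arm → ℝ
  val : List Arm → ℝ
  -- These four fields are the two conditions of reasonable beliefs, in terms of odds.
  good_safe : ∀ h, good (.S :: h)
  odds_safe : ∀ h, odds (.S :: h) = r0 * (1 - lam) ^ numExp h
  good_fresh : ∀ h a, good (.R :: a :: .S :: h)
  odds_fresh : ∀ h a, odds (.R :: a :: .S :: h) = r0 * (1 - lam) ^ numExp (a :: h)
  -- An `R` that is chosen even without a success is no news, so only the failure of the player's
  -- own move `x` changes the odds.
  good_pool : ∀ h x, good h → act (x :: h) = .R → good (.R :: x :: h)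
  odds_pool : ∀ h x, good h → act (x :: h) = .R →
    odds (.R :: x :: h) = odds h * (1 - lam) ^ numExp [x]
  -- The odds of the good state without any success are `r0 * (1 - lam) ^ numExp h`. If `odds h` is
  -- larger, an earlier success of the other player is possible, and an `R` that an unsuccessful
  -- player would not choose proves it.
  act_revealed : ∀ h x, good h → r0 * (1 - lam) ^ numExp h < odds h → act (x :: h) = .S →
    act (.R :: x :: h) = .R
  le_odds : ∀ h, good h → r0 * (1 - lam) ^ numExp h ≤ odds h
  val_nonneg : ∀ h, good h → 0 ≤ val h
  val_le : ∀ h, good h → val h ≤ odds h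
  -- In the separating case the difference of odds is the weight of an earlier success of the other
  -- player. His `R` reveals it, and it is worth `g`, hence `1` after normalization.
  safe_le : ∀ h, good h →
    δ * (if act (.S :: h) = .S then
        val (.S :: .S :: h) + (odds h - r0 * (1 - lam) ^ numExp h)
      else val (.R :: .S :: h)) ≤ val h
  risky_le : ∀ h, good h →
    odds h * (1 - δ) - K + δ * (odds h * lam + (if act (.R :: h) = .S then
        val (.S :: .R :: h) + (1 - lam) * (odds h - r0 * (1 - lam) ^ numExp h)
      else val (.R :: .R :: h))) ≤ val h
  val_safe : ∀ h, good h → act h = .S → val h =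
    δ * (if act (.S :: h) = .S then
        val (.S :: .S :: h) + (odds h - r0 * (1 - lam) ^ numExp h)
      else val (.R :: .S :: h))
  val_risky : ∀ h, good h → act h = .R → val h =
    odds h * (1 - δ) - K + δ * (odds h * lam + (if act (.R :: h) = .S then
        val (.S :: .R :: h) + (1 - lam) * (odds h - r0 * (1 - lam) ^ numExp h)
      else val (.R :: .R :: h)))

theorem Arm.ne_S_iff (a : Arm) : a ≠ .S ↔ a = .R := by cases a <;> simp

theorem le_of_forall_le_add_pow {a b C δ : ℝ} (h0 : 0 ≤ δ) (h1 : δ < 1)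
    (h : ∀ k : ℕ, a ≤ b + δ ^ k * C) : a ≤ b := by
  have ht : Filter.Tendsto (fun k : ℕ => b + δ ^ k * C) Filter.atTop (nhds (b + 0 * C)) :=
    ((tendsto_pow_atTop_nhds_zero_of_lt_one h0 h1).mul_const C).const_add b
  simpa using ge_of_tendsto' ht h

/-! ### Bounds for values, and stopping by backward induction -/

namespace Reduced

variable {lam δ K r0 : ℝ}

/-- If from `h` on nobody experiments until a success is revealed, the value is zero. -/
theorem val_eq_zero (E : Reduced lam δ K r0) (hδ : δ ∈ Set.Ioo (0 : ℝ) 1) (P : List Arm → Prop)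
    (hP : ∀ h, P h → P (.S :: h) ∧ E.act (.S :: h) = .S) {h : List Arm} (hh : P h) :
    E.val (.S :: h) = 0 := by
  -- After an `S` the odds are those of no success at all, so there is nothing to be revealed and
  -- the value is only discounted, period after period.
  have key : ∀ (k : ℕ) (h : List Arm), P h →
      E.val (.S :: h) ≤ 0 + δ ^ k * (r0 * (1 - lam) ^ numExp h) := by
    intro k
    induction k with
    | zero =>
      intro h _
      have := E.val_le _ (E.good_safe h)
      rw [E.odds_safe] at this
      simpa using this
    | succ k ih =>
      intro h hh
      obtain ⟨h1, h2⟩ := hP h hh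
      obtain ⟨h3, h4⟩ := hP _ h1
      have e := E.val_safe _ (E.good_safe h) h2
      rw [if_pos h4, E.odds_safe] at e
      have := ih _ h3
      simp only [numExp_safe] at e this
      rw [e, pow_succ]
      nlinarith [hδ.1]
  exact le_antisymm (le_of_forall_le_add_pow hδ.1.le hδ.2 fun k => key k h hh)
    (E.val_nonneg _ (E.good_safe h))

/-- Nobody experiments after the other player chose the safe arm, once there have been more than
`n` experiments. -/
def StopAfter (E : Reduced lam δ K r0) (n : ℕ) : Prop := ∀ h, n < numExp h → E.act (.S :: h) = .S

variable {E : Reduced lam δ K r0}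

theorem StopAfter.val_eq_zero {n : ℕ} (hn : E.StopAfter n) (hδ : δ ∈ Set.Ioo (0 : ℝ) 1)
    {h : List Arm} (hh : n < numExp h) : E.val (.S :: h) = 0 :=
  E.val_eq_zero hδ (fun h => n < numExp h) (fun h hh => ⟨by simpa using hh, hn h hh⟩) hh

/-- The value of a player who waits for the other player's success to be revealed. -/
theorem StopAfter.wait_le {n : ℕ} (hn : E.StopAfter n) (hδ : δ ∈ Set.Ioo (0 : ℝ) 1)
    {h : List Arm} (hh : n < numExp h) (hg : E.good h) :
    δ * (E.odds h - r0 * (1 - lam) ^ numExp h) ≤ E.val h := by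
  have := E.safe_le h hg
  rwa [if_pos (hn h hh), hn.val_eq_zero hδ (by simpa using hh), zero_add] at this

/-- Below the encouragement cut-off, waiting for the other player's success to be revealed is
best. -/
theorem StopAfter.val_le_wait (hlam : lam ∈ Set.Ioo (0 : ℝ) 1) (hδ : δ ∈ Set.Ioo (0 : ℝ) 1)
    (hr0 : 0 < r0) {n : ℕ} (hn : E.StopAfter n) {h : List Arm}
    (hh : n < numExp h) (hg : E.good h) (ho : E.odds h * (1 - δ + lam * δ * (1 + δ - lam * δ)) ≤ K) :
    E.val h ≤ δ * (E.odds h - r0 * (1 - lam) ^ numExp h) := by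
  obtain ⟨hl0, hl1⟩ := hlam
  obtain ⟨hd0, hd1⟩ := hδ
  -- Pooled experiments may go on without end. The error term bounds the value left after `k`
  -- periods, and it vanishes as `k` grows.
  have key : ∀ (k : ℕ) (h : List Arm), n < numExp h → E.good h →
      E.odds h * (1 - δ + lam * δ * (1 + δ - lam * δ)) ≤ K →
      E.val h ≤ δ * (E.odds h - r0 * (1 - lam) ^ numExp h) + δ ^ k * E.odds h := by
    intro k
    induction k with
    | zero =>
      intro h _ hg _
      have h1 := E.val_le _ hg
      have h2 := E.le_odds h hg
      nlinarith
    | succ k ih =>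
      intro h hh hg ho
      have hle := E.le_odds h hg
      have hr : 0 < r0 * (1 - lam) ^ numExp h := mul_pos hr0 (pow_pos (by linarith) _)
      have hp : 0 < δ ^ (k + 1) := pow_pos hd0 _
      have hge : 0 ≤ δ ^ (k + 1) * E.odds h := mul_nonneg hp.le (by linarith)
      rcases ha : E.act h with _ | _
      · rw [E.val_safe h hg ha, if_pos (hn h hh),
          hn.val_eq_zero ⟨hd0, hd1⟩ (by simpa using hh)]
        linarith
      · rw [E.val_risky h hg ha]
        split_ifs with hb
        · rw [hn.val_eq_zero ⟨hd0, hd1⟩ (by simp; omega)]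
          have : 0 < E.odds h * (lam * δ * (δ - lam * δ)) :=
            mul_pos (by linarith) (mul_pos (mul_pos hl0 hd0) (by nlinarith))
          have : δ * lam * (r0 * (1 - lam) ^ numExp h) ≤ δ * lam * E.odds h :=
            mul_le_mul_of_nonneg_left hle (by positivity)
          nlinarith
        · have hb' := (Arm.ne_S_iff _).1 hb
          have hg' := E.good_pool h .R hg hb'
          have eo := E.odds_pool h .R hg hb'
          have e1 : numExp [Arm.R] = 1 := rfl
          rw [e1, pow_one] at eo
          have := ih (.R :: .R :: h) (by simp; omega) hg' (by
            rw [eo]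
            refine le_trans ?_ ho
            have hA : 0 ≤ 1 - δ + lam * δ * (1 + δ - lam * δ) := by
              have : 0 < lam * δ * (1 + δ - lam * δ) :=
                mul_pos (mul_pos hl0 hd0) (by nlinarith)
              linarith
            have : E.odds h * (1 - lam) ≤ E.odds h := by nlinarith
            exact mul_le_mul_of_nonneg_right this hA)
          rw [eo] at this
          simp only [numExp_risky, pow_succ] at this
          set r := r0 * (1 - lam) ^ numExp h
          set ρ := E.odds h
          have er : r0 * ((1 - lam) ^ numExp h * (1 - lam) * (1 - lam)) = r * (1 - lam) ^ 2 := by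
            simp only [r]; ring
          rw [er] at this
          have h3 : δ * E.val (.R :: .R :: h) ≤
              δ * (δ * (ρ * (1 - lam) - r * (1 - lam) ^ 2) + δ ^ k * (ρ * (1 - lam))) :=
            mul_le_mul_of_nonneg_left this hd0.le
          have h4 : 0 ≤ δ ^ k * δ * ρ * lam := by
            have : 0 ≤ δ ^ k * δ * ρ := by rw [← pow_succ]; exact hge
            positivity
          -- Split `ρ(1 - λ) - r(1 - λ)²` as `ρλ(1 - λ) + (ρ - r)(1 - λ)²`. The first part completes
          -- the flow terms to `ρA - K ≤ 0`; the second, discounted twice, is at most `δ(ρ - r)` by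
          -- `h5`.
          have h5 : 0 ≤ δ * (1 - δ * (1 - lam) ^ 2) * (ρ - r) := by
            apply mul_nonneg (mul_nonneg hd0.le _) (by linarith)
            have : (1 - lam) ^ 2 ≤ 1 := by nlinarith
            nlinarith
          rw [pow_succ]
          nlinarith
  exact le_of_forall_le_add_pow hd0.le hd1 fun k => key k h hh hg ho

/-- A bound for the value of an experiment below the encouragement cut-off. -/
theorem StopAfter.risky_le_wait (hlam : lam ∈ Set.Ioo (0 : ℝ) 1) (hδ : δ ∈ Set.Ioo (0 : ℝ) 1)
    (hr0 : 0 < r0)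
    {n : ℕ} (hn : E.StopAfter n) {h : List Arm} (hh : n ≤ numExp h)
    (hg : E.good h) (ho : E.odds h * (1 - δ + lam * δ * (1 + δ - lam * δ)) ≤ K)
    (ha : E.act h = .R) :
    E.val h ≤ δ * (E.odds h - r0 * (1 - lam) ^ numExp h) +
      (E.odds h * (1 - δ + lam * δ * (1 + δ - lam * δ)) - K) -
      δ * lam * (E.odds h - r0 * (1 - lam) ^ numExp h) := by
  have hl0 := hlam.1
  have hl1 := hlam.2
  have hd0 := hδ.1
  have hd1 := hδ.2
  have hle := E.le_odds h hg
  have hr : 0 < r0 * (1 - lam) ^ numExp h := mul_pos hr0 (pow_pos (by linarith) _)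
  rw [E.val_risky h hg ha]
  split_ifs with hb
  · rw [hn.val_eq_zero ⟨hd0, hd1⟩ (by simp; omega)]
    have : 0 < E.odds h * (lam * δ * (δ - lam * δ)) :=
      mul_pos (by linarith) (mul_pos (mul_pos hl0 hd0) (by nlinarith))
    nlinarith
  · have hb' := (Arm.ne_S_iff _).1 hb
    have hg' := E.good_pool h .R hg hb'
    have eo := E.odds_pool h .R hg hb'
    have e1 : numExp [Arm.R] = 1 := rfl
    rw [e1, pow_one] at eo
    have hA : 0 ≤ 1 - δ + lam * δ * (1 + δ - lam * δ) := by
      have : 0 < lam * δ * (1 + δ - lam * δ) :=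
        mul_pos (mul_pos hl0 hd0) (by nlinarith)
      linarith
    have := hn.val_le_wait hlam hδ hr0 (h := .R :: .R :: h) (by simp; omega) hg' (by
      rw [eo]
      refine le_trans ?_ ho
      have : E.odds h * (1 - lam) ≤ E.odds h := by nlinarith
      exact mul_le_mul_of_nonneg_right this hA)
    rw [eo] at this
    simp only [numExp_risky, pow_succ] at this
    set r := r0 * (1 - lam) ^ numExp h
    set ρ := E.odds h
    have er : r0 * ((1 - lam) ^ numExp h * (1 - lam) * (1 - lam)) = r * (1 - lam) ^ 2 := by
      simp only [r]; ring
    rw [er] at this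
    have h3 : δ * E.val (.R :: .R :: h) ≤ δ * (δ * (ρ * (1 - lam) - r * (1 - lam) ^ 2)) :=
      mul_le_mul_of_nonneg_left this hd0.le
    -- The same splitting, but now `δ²(1 - λ)²(ρ - r)` is compared with `δ(1 - λ)(ρ - r)`. The gap
    -- to `δ(ρ - r)` makes waiting strictly better as soon as `ρ > r`.
    have h6 : 0 ≤ δ * (1 - lam - δ * (1 - lam) ^ 2) := by
      apply mul_nonneg hd0.le
      have : (1 - lam) ^ 2 ≤ 1 - lam := by nlinarith
      nlinarith [sq_nonneg (1 - lam)]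
    have h5 := mul_nonneg h6 (sub_nonneg.2 hle)
    nlinarith

/-- Below the encouragement cut-off, a player with something to learn does not experiment. -/
theorem StopAfter.act_eq_safe (hlam : lam ∈ Set.Ioo (0 : ℝ) 1) (hδ : δ ∈ Set.Ioo (0 : ℝ) 1)
    (hr0 : 0 < r0)
    {n : ℕ} (hn : E.StopAfter n) {h : List Arm} (hh : n < numExp h)
    (hg : E.good h) (ho : E.odds h * (1 - δ + lam * δ * (1 + δ - lam * δ)) ≤ K)
    (hs : r0 * (1 - lam) ^ numExp h < E.odds h) : E.act h = .S := by
  by_contra ha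
  have h1 := hn.risky_le_wait hlam hδ hr0 hh.le hg ho ((Arm.ne_S_iff _).1 ha)
  have h2 := hn.wait_le hδ hh hg
  have h3 := mul_pos (mul_pos hδ.1 hlam.1) (sub_pos.2 hs)
  linarith

/-- An experiment at odds `r` is worth at most `r - K`, since no continuation value exceeds the
odds. This is negative after enough failures, which starts the backward induction. -/
theorem exists_stopAfter (E : Reduced lam δ K r0) (hlam : lam ∈ Set.Ioo (0 : ℝ) 1)
    (hδ : δ ∈ Set.Ioo (0 : ℝ) 1) (hr0 : 0 < r0) (hK : 0 < K) : ∃ n, E.StopAfter n := by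
  obtain ⟨hl0, hl1⟩ := hlam
  obtain ⟨n, hn⟩ := exists_pow_lt_of_lt_one (div_pos hK hr0) (by linarith : 1 - lam < 1)
  refine ⟨n, fun h hh => ?_⟩
  by_contra ha
  have hr : r0 * (1 - lam) ^ numExp h < K := by
    have := pow_le_pow_of_le_one (by linarith : 0 ≤ 1 - lam) (by linarith) hh.le
    rw [lt_div_iff₀ hr0] at hn
    nlinarith
  have hr' : 0 < r0 * (1 - lam) ^ numExp h := mul_pos hr0 (pow_pos (by linarith) _)
  have hv := E.val_nonneg _ (E.good_safe h)
  rw [E.val_risky _ (E.good_safe h) ((Arm.ne_S_iff _).1 ha)] at hv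
  have ho := E.odds_safe h
  simp only [numExp_safe, ho] at hv
  have hX : (if E.act (.R :: .S :: h) = .S then E.val (.S :: .R :: .S :: h) +
      (1 - lam) * (r0 * (1 - lam) ^ numExp h - r0 * (1 - lam) ^ numExp h)
      else E.val (.R :: .R :: .S :: h)) ≤ (1 - lam) * (r0 * (1 - lam) ^ numExp h) := by
    split_ifs with hb
    · have := E.val_le _ (E.good_safe (.R :: .S :: h))
      rw [E.odds_safe] at this
      simp only [numExp_safe, numExp_risky, pow_succ] at this
      linarith
    · have hb' := (Arm.ne_S_iff _).1 hb
      have := E.val_le _ (E.good_pool _ _ (E.good_safe h) hb')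
      rw [E.odds_pool _ _ (E.good_safe h) hb', ho, show numExp [Arm.R] = 1 from rfl] at this
      linarith
  have := mul_le_mul_of_nonneg_left hX hδ.1.le
  nlinarith

/-- Nobody experiments below the encouragement cut-off. -/
theorem stopAfter_of_lt (E : Reduced lam δ K r0) (hlam : lam ∈ Set.Ioo (0 : ℝ) 1)
    (hδ : δ ∈ Set.Ioo (0 : ℝ) 1) (hr0 : 0 < r0) (hK : 0 < K) {n : ℕ}
    (hn : r0 * (1 - lam) ^ (n + 1) * (1 - δ + lam * δ * (1 + δ - lam * δ)) < K) :
    E.StopAfter n := by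
  have hl0 := hlam.1
  have hl1 := hlam.2
  have hA : 0 ≤ 1 - δ + lam * δ * (1 + δ - lam * δ) := by
    have : 0 < lam * δ * (1 + δ - lam * δ) :=
      mul_pos (mul_pos hl0 hδ.1) (by nlinarith [hδ.1, hδ.2])
    linarith [hδ.2]
  -- One layer at a time: after an `S` there is nothing to learn from the other player, so
  -- `risky_le_wait` leaves at most `rA - K < 0` for an experiment.
  have key : ∀ k, E.StopAfter (n + k) → E.StopAfter n := by
    intro k
    induction k with
    | zero => exact id
    | succ k ih =>
      intro hs
      refine ih fun h hh => ?_
      rcases Nat.lt_or_ge (n + (k + 1)) (numExp h) with h1 | h1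
      · exact hs h h1
      have h2 : numExp h = n + 1 + k := by omega
      have hlt : r0 * (1 - lam) ^ numExp h * (1 - δ + lam * δ * (1 + δ - lam * δ)) < K := by
        refine lt_of_le_of_lt ?_ hn
        refine mul_le_mul_of_nonneg_right (mul_le_mul_of_nonneg_left ?_ hr0.le) hA
        exact pow_le_pow_of_le_one (by linarith) (by linarith) (by omega)
      by_contra ha
      have ho := E.odds_safe h
      have h3 := hs.risky_le_wait hlam hδ hr0 (h := .S :: h) (by simp; omega) (E.good_safe h)
        (by rw [ho]; exact hlt.le) ((Arm.ne_S_iff _).1 ha)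
      have hv := E.val_nonneg _ (E.good_safe h)
      simp only [ho, numExp_safe] at h3
      linarith
  obtain ⟨N, hN⟩ := E.exists_stopAfter hlam hδ hr0 hK
  exact key N fun h hh => hN h (by omega)

/-- The odds after `n` failures are at most the encouragement cut-off, and nobody experiments
after more failures. -/
structure Critical (E : Reduced lam δ K r0) (n : ℕ) : Prop where
  hlam : lam ∈ Set.Ioo (0 : ℝ) 1
  hδ : δ ∈ Set.Ioo (0 : ℝ) 1
  hr0 : 0 < r0
  stopAfter : E.StopAfter n
  odds_le : r0 * (1 - lam) ^ n * (1 - δ + lam * δ * (1 + δ - lam * δ)) ≤ K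

/-! ### Behaviour at the encouragement cut-off and one failure above it -/

namespace Critical

variable {n : ℕ}

theorem fail_pos (C : E.Critical n) (k : ℕ) : 0 < r0 * (1 - lam) ^ k :=
  mul_pos C.hr0 (pow_pos (by linarith [C.hlam.2]) _)

theorem fail_lt (C : E.Critical n) {j k : ℕ} (hjk : j < k) :
    r0 * (1 - lam) ^ k < r0 * (1 - lam) ^ j :=
  mul_lt_mul_of_pos_left
    (pow_lt_pow_right_of_lt_one₀ (by linarith [C.hlam.2]) (by linarith [C.hlam.1]) hjk) C.hr0

theorem fail_le (C : E.Critical n) {k : ℕ} (hk : n ≤ k) :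
    r0 * (1 - lam) ^ k * (1 - δ + lam * δ * (1 + δ - lam * δ)) ≤ K := by
  have hA : 0 ≤ 1 - δ + lam * δ * (1 + δ - lam * δ) := by
    have : 0 < lam * δ * (1 + δ - lam * δ) :=
      mul_pos (mul_pos C.hlam.1 C.hδ.1) (by nlinarith [C.hδ.1, C.hδ.2, C.hlam.1, C.hlam.2])
    linarith [C.hδ.2]
  refine le_trans (mul_le_mul_of_nonneg_right (mul_le_mul_of_nonneg_left ?_ C.hr0.le) hA)
    C.odds_le
  exact pow_le_pow_of_le_one (by linarith [C.hlam.2]) (by linarith [C.hlam.1]) hk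

/-- Without encouragement, experiments below the encouragement cut-off have a negative value. -/
theorem fail_single (C : E.Critical n) {k : ℕ} (hk : n ≤ k) :
    r0 * (1 - lam) ^ k * (1 - δ + δ * lam) < K := by
  refine lt_of_lt_of_le ?_ (C.fail_le hk)
  refine mul_lt_mul_of_pos_left ?_ (C.fail_pos k)
  have : 0 < lam * δ * (δ - lam * δ) :=
    mul_pos (mul_pos C.hlam.1 C.hδ.1) (by nlinarith [C.hδ.1, C.hδ.2, C.hlam.1, C.hlam.2])
  nlinarith

/-- Only `numExp h = n` is left. An `R` following two safe choices is uninformative by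
reasonableness, so the other player sees a possible success, is below the encouragement cut-off, and
waits. The experiment is not encouraged and does not pay. -/
theorem act_two_safe (C : E.Critical n) {h : List Arm} (hh : n ≤ numExp h) :
    E.act (.S :: .S :: h) = .S := by
  rcases hh.lt_or_eq with h1 | h1
  · exact C.stopAfter _ (by simpa using h1)
  by_contra ha
  have ha' := (Arm.ne_S_iff _).1 ha
  have ho := E.odds_fresh h .S
  simp only [numExp_safe, ← h1] at ho
  have hS : E.act (.R :: .S :: .S :: h) = .S :=
    C.stopAfter.act_eq_safe C.hlam C.hδ C.hr0 (by simp; omega) (E.good_fresh h .S)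
      (by rw [ho]; exact C.odds_le)
      (by rw [ho]; simp only [numExp_risky, numExp_safe, ← h1]; exact C.fail_lt (by omega))
  have hv := E.val_nonneg _ (E.good_safe (.S :: h))
  rw [E.val_risky _ (E.good_safe _) ha', if_pos hS,
    C.stopAfter.val_eq_zero C.hδ (by simp; omega), E.odds_safe] at hv
  simp only [numExp_safe, ← h1] at hv
  have := C.fail_single le_rfl
  linarith

/-- This covers equality with the cut-off, where an experiment right after `S` is not excluded but
is worth at most `rA - K ≤ 0`. -/
theorem val_eq_zero (C : E.Critical n) {h : List Arm} (hh : n ≤ numExp h) :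
    E.val (.S :: h) = 0 := by
  have h2 : ∀ h, n ≤ numExp h → E.val (.S :: .S :: h) = 0 := fun h hh =>
    E.val_eq_zero C.hδ (fun k => ∃ h, k = .S :: h ∧ n ≤ numExp h)
      (by rintro _ ⟨h, rfl, hh⟩; exact ⟨⟨_, rfl, by simpa using hh⟩, C.act_two_safe hh⟩)
      ⟨h, rfl, hh⟩
  have ho := E.odds_safe h
  rcases ha : E.act (.S :: h) with _ | _
  · rw [E.val_safe _ (E.good_safe h) ha, if_pos (C.act_two_safe hh), ho, h2 _ (by simpa using hh)]
    simp
  · have := C.stopAfter.risky_le_wait C.hlam C.hδ C.hr0 (h := .S :: h) (by simpa using hh)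
      (E.good_safe h) (by rw [ho]; exact C.fail_le hh) ha
    simp only [ho, numExp_safe] at this
    have := C.fail_le hh
    have := E.val_nonneg _ (E.good_safe h)
    linarith

/-- Waiting beats experimenting if both choices make the other player reveal a success. -/
theorem act_eq_safe_of_revealing (C : E.Critical n) {k : List Arm} (hk : n ≤ numExp k)
    (hg : E.good k) (ho : E.odds k * (1 - δ + δ * lam * (1 - lam)) < K)
    (hr : r0 * (1 - lam) ^ numExp k ≤ (1 - lam) * E.odds k)
    (hS : E.act (.S :: k) = .S) (hR : E.act (.R :: k) = .S) : E.act k = .S := by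
  by_contra ha
  have h1 := E.val_risky _ hg ((Arm.ne_S_iff _).1 ha)
  have h2 := E.safe_le _ hg
  rw [if_pos hR, C.val_eq_zero (by simp; omega)] at h1
  rw [if_pos hS, C.val_eq_zero (by simpa using hk)] at h2
  -- Experimenting minus waiting is `ρ(1 - δ) - K + δλr`; replacing `r` by its bound `(1 - λ)ρ`
  -- produces the factor that defines `p*_1`.
  have := mul_le_mul_of_nonneg_left hr (mul_nonneg C.hδ.1.le C.hlam.1.le)
  nlinarith

/-- A player whose past experiments are the only reason why the other player is optimistic stops
when the other player waits. -/
theorem act_safe_cons (C : E.Critical n) {k : List Arm} (hk : n ≤ numExp k)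
    (hg : E.good k) (ho : E.odds k * (1 - δ + δ * lam * (1 - lam)) < K)
    (hr : r0 * (1 - lam) ^ numExp k ≤ (1 - lam) * E.odds k) : E.act (.S :: k) = .S := by
  by_contra ha
  have ha' := (Arm.ne_S_iff _).1 ha
  have eS := E.odds_safe k
  rcases hb : E.act (.R :: .S :: k) with _ | _
  · have hv := E.val_nonneg _ (E.good_safe k)
    rw [E.val_risky _ (E.good_safe k) ha', if_pos hb,
      C.val_eq_zero (by simp; omega), eS] at hv
    simp only [numExp_safe] at hv
    have := C.fail_single hk
    linarith
  -- The experiment is pooled, so the other player keeps the odds of `k`. Whatever he does, his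
  -- opponent then reveals his results, so his reply `R` is worse than waiting.
  · have hg1 := E.good_pool k .S hg ha'
    have eo1 := E.odds_pool k .S hg ha'
    rw [show numExp [Arm.S] = 0 from rfl, pow_zero, mul_one] at eo1
    have hg2 := E.good_pool _ .R (E.good_safe k) hb
    have eo2 := E.odds_pool _ .R (E.good_safe k) hb
    rw [show numExp [Arm.R] = 1 from rfl, eS, mul_assoc, ← pow_add] at eo2
    have hR : E.act (.R :: .R :: .S :: k) = .S := by
      refine C.stopAfter.act_eq_safe C.hlam C.hδ C.hr0 (by simp; omega) hg2 ?_ ?_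
      · rw [eo2]; exact C.fail_le (by omega)
      · rw [eo2]; simp only [numExp_risky, numExp_safe]; exact C.fail_lt (by omega)
    have := C.act_eq_safe_of_revealing (k := .R :: .S :: k) (by simp; omega) hg1
      (by rwa [eo1])
      (by
        rw [eo1]
        refine le_trans (le_of_lt ?_) hr
        simp only [numExp_risky, numExp_safe]
        exact C.fail_lt (by omega))
      (C.stopAfter _ (by simp; omega)) hR
    rw [hb] at this
    cases this

/-- Nobody starts experimenting one failure above the encouragement cut-off. -/
theorem act_two_safe_pred {n : ℕ} (C : E.Critical (n + 1))
    (hn : r0 * (1 - lam) ^ n * (1 - δ + δ * lam) < K) {h : List Arm} (hh : numExp h = n) :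
    E.act (.S :: .S :: h) = .S := by
  by_contra ha
  have ha' := (Arm.ne_S_iff _).1 ha
  have ho := E.odds_fresh h .S
  have hg := E.good_fresh h .S
  simp only [numExp_safe, hh] at ho
  rcases hb : E.act (.R :: .S :: .S :: h) with _ | _
  · have hv := E.val_nonneg _ (E.good_safe (.S :: h))
    rw [E.val_risky _ (E.good_safe _) ha', if_pos hb, C.val_eq_zero (by simp; omega),
      E.odds_safe] at hv
    simp only [numExp_safe, hh] at hv
    linarith
  -- The reply `R` is excluded: either choice makes the first experimenter reveal his result, and
  -- the replying player is below `p*_1`.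
  · have hg2 := E.good_pool _ .R (E.good_safe (.S :: h)) hb
    have eo2 := E.odds_pool _ .R (E.good_safe (.S :: h)) hb
    rw [show numExp [Arm.R] = 1 from rfl, E.odds_safe, mul_assoc, ← pow_add] at eo2
    simp only [numExp_safe, hh] at eo2
    have hp := C.fail_pos n
    have hlt : E.odds (.R :: .S :: .S :: h) * (1 - δ + δ * lam * (1 - lam)) < K := by
      rw [ho]
      refine lt_of_le_of_lt (mul_le_mul_of_nonneg_left ?_ hp.le) hn
      nlinarith [mul_pos C.hδ.1 (mul_pos C.hlam.1 C.hlam.1)]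
    have hr : r0 * (1 - lam) ^ numExp (.R :: .S :: .S :: h) ≤
        (1 - lam) * E.odds (.R :: .S :: .S :: h) := by
      rw [ho]
      simp only [numExp_risky, numExp_safe, hh, pow_succ]
      linarith
    have hR : E.act (.R :: .R :: .S :: .S :: h) = .S := by
      refine C.stopAfter.act_eq_safe C.hlam C.hδ C.hr0 (by simp; omega) hg2 ?_ ?_
      · rw [eo2]; exact C.odds_le
      · rw [eo2]; simp only [numExp_risky, numExp_safe, hh]; exact C.fail_lt (by omega)
    have := C.act_eq_safe_of_revealing (by simp; omega) hg hlt hr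
      (C.act_safe_cons (by simp; omega) hg hlt hr) hR
    rw [hb] at this
    cases this

end Critical

/-- The critical player has the odds `r0 * (1 - lam) ^ (n + 1)`, too low for an isolated experiment
by `h2` and high enough for an encouraged one by `h1`. By `h3` the other player replies `R` only to
what he takes for a success. Hence the critical player can neither stop nor experiment. -/
theorem false_of_odds (E : Reduced lam δ K r0) (hlam : lam ∈ Set.Ioo (0 : ℝ) 1)
    (hδ : δ ∈ Set.Ioo (0 : ℝ) 1) (hr0 : 0 < r0) {n : ℕ} (C : E.Critical (n + 2))
    (h1 : K < r0 * (1 - lam) ^ (n + 1) * (1 - δ + lam * δ * (1 + δ - lam * δ)))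
    (h2 : r0 * (1 - lam) ^ (n + 1) * (1 - δ + δ * lam) < K)
    (h3 : r0 * (1 - lam) ^ n * (1 - δ + δ * lam * (1 - lam)) < K) : False := by
  obtain ⟨h, hh⟩ : ∃ h : List Arm, numExp h = n := ⟨List.replicate n .R, by simp [numExp]⟩
  -- A fresh experiment after two safe choices: by reasonableness the active player does not update
  -- on it, so his odds still count `n` failures while `k` contains `n + 1` experiments.
  set k : List Arm := .R :: .S :: .S :: h with hk
  have hkn : numExp k = n + 1 := by simp [hk, hh]
  have hgk : E.good k := E.good_fresh h .S
  have hok : E.odds k = r0 * (1 - lam) ^ n := by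
    have := E.odds_fresh h .S
    simpa [hh] using this
  have hoS : E.odds (.S :: k) = r0 * (1 - lam) ^ (n + 1) := by rw [E.odds_safe, hkn]
  have hgS := E.good_safe k
  have hfresh : ∀ l, numExp l = n + 1 → E.act (.S :: .S :: l) = .S := fun l hl =>
    C.act_two_safe_pred (n := n + 1) h2 hl
  rcases ha : E.act (.S :: k) with _ | _
  -- The critical player stops. Then his value is zero, but an `R` would pass for a success and be
  -- answered by `R`.
  · have hR : E.act (.R :: .S :: k) = .R :=
      E.act_revealed k .S hgk (by rw [hok, hkn]; exact C.fail_lt (by omega)) ha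
    have hv : E.val (.S :: k) = 0 := by
      rw [E.val_safe _ hgS ha, if_pos (hfresh k hkn), hoS, numExp_safe, hkn,
        E.val_eq_zero hδ (fun l => ∃ h, l = .S :: h ∧ numExp h = n + 1)
          (by rintro _ ⟨l, rfl, hl⟩; exact ⟨⟨_, rfl, by simpa using hl⟩, hfresh l hl⟩)
          ⟨.S :: k, rfl, by simpa using hkn⟩]
      simp
    have hg2 := E.good_pool _ .R hgS hR
    have eo2 := E.odds_pool _ .R hgS hR
    rw [show numExp [Arm.R] = 1 from rfl, hoS, pow_one] at eo2
    have hw := C.stopAfter.wait_le hδ (by simp; omega) hg2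
    have hQ := E.risky_le _ hgS
    rw [hR, if_neg (by simp), hv, hoS] at hQ
    rw [eo2] at hw
    simp only [numExp_risky, numExp_safe, hkn, pow_succ] at hw hQ h1
    have := mul_le_mul_of_nonneg_left hw hδ.1.le
    nlinarith
  -- The critical player experiments even without a success. Then the reply `S` makes his experiment
  -- a loss, and the reply `R` is not optimal below `p*_1`.
  · have hg1 := E.good_pool k .S hgk ha
    have eo1 := E.odds_pool k .S hgk ha
    rw [show numExp [Arm.S] = 0 from rfl, pow_zero, mul_one, hok] at eo1
    rcases hb : E.act (.R :: .S :: k) with _ | _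
    · have hv := E.val_nonneg _ hgS
      rw [E.val_risky _ hgS ha, if_pos hb, C.val_eq_zero (by simp; omega), hoS] at hv
      simp only [numExp_safe, hkn] at hv
      linarith
    · have hg2 := E.good_pool _ .R hgS hb
      have eo2 := E.odds_pool _ .R hgS hb
      rw [show numExp [Arm.R] = 1 from rfl, hoS, mul_assoc, ← pow_add] at eo2
      have hR : E.act (.R :: .R :: .S :: k) = .S := by
        refine C.stopAfter.act_eq_safe hlam hδ hr0 (by simp; omega) hg2 ?_ ?_
        · rw [eo2]; exact C.odds_le
        · rw [eo2]; simp only [numExp_risky, numExp_safe, hkn]; exact C.fail_lt (by omega)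
      have hlt : E.odds (.R :: .S :: k) * (1 - δ + δ * lam * (1 - lam)) < K := by rwa [eo1]
      have hr : r0 * (1 - lam) ^ numExp (.R :: .S :: k) ≤ (1 - lam) * E.odds (.R :: .S :: k) := by
        rw [eo1]
        have := C.fail_lt (j := n + 1) (k := n + 2) (by omega)
        simp only [numExp_risky, numExp_safe, hkn]
        have e : (1 - lam) * (r0 * (1 - lam) ^ n) = r0 * (1 - lam) ^ (n + 1) := by ring
        rw [e]
        exact this.le
      have := C.act_eq_safe_of_revealing (by simp; omega) hg1 hlt hr
        (C.act_safe_cons (by simp; omega) hg1 hlt hr) hR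
      rw [hb] at this
      cases this

/-- There is no reduced equilibrium if the odds after one failure exceed the encouragement
cut-off, which is large enough relative to the one-player cut-off. -/
theorem false_of_cutoffs (E : Reduced lam δ K r0) (hlam : lam ∈ Set.Ioo (0 : ℝ) 1)
    (hδ : δ ∈ Set.Ioo (0 : ℝ) 1) (hr0 : 0 < r0) (hK : 0 < K)
    (h1 : K < r0 * (1 - lam) * (1 - δ + lam * δ * (1 + δ - lam * δ)))
    (h3 : r0 * (1 - δ + δ * lam * (1 - lam)) < K) : False := by
  obtain ⟨hl0, hl1⟩ := hlam
  obtain ⟨hd0, hd1⟩ := hδ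
  set A := 1 - δ + lam * δ * (1 + δ - lam * δ) with hAdef
  have hA : 0 < A := by
    have : 0 < lam * δ * (1 + δ - lam * δ) := mul_pos (mul_pos hl0 hd0) (by nlinarith)
    linarith
  -- The least such exponent is the critical number of failures. By `h1` it is neither `0` nor `1`.
  have hex : ∃ n, r0 * (1 - lam) ^ n * A ≤ K := by
    obtain ⟨n, hn⟩ := exists_pow_lt_of_lt_one (div_pos hK (mul_pos hr0 hA))
      (by linarith : 1 - lam < 1)
    rw [lt_div_iff₀ (mul_pos hr0 hA)] at hn
    exact ⟨n, by nlinarith⟩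
  classical
  have hspec := Nat.find_spec hex
  have hmin : ∀ m < Nat.find hex, K < r0 * (1 - lam) ^ m * A := fun m hm =>
    not_le.1 (Nat.find_min hex hm)
  have hge : 2 ≤ Nat.find hex := by
    by_contra hlt
    rcases (by omega : Nat.find hex = 0 ∨ Nat.find hex = 1) with e | e <;> rw [e] at hspec
    · have : r0 * (1 - lam) * A ≤ r0 * A :=
        mul_le_mul_of_nonneg_right (by nlinarith) hA.le
      simp only [pow_zero, mul_one] at hspec
      linarith
    · rw [pow_one] at hspec
      linarith
  obtain ⟨n, hn⟩ := Nat.exists_eq_add_of_le hge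
  rw [add_comm] at hn
  rw [hn] at hspec hmin
  have hpow : ∀ m : ℕ, 0 < r0 * (1 - lam) ^ m := fun m =>
    mul_pos hr0 (pow_pos (by linarith) _)
  have hstep : r0 * (1 - lam) ^ (n + 2 + 1) * A < K := by
    refine lt_of_lt_of_le ?_ hspec
    rw [pow_succ _ (n + 2), ← mul_assoc]
    nlinarith [mul_pos (hpow (n + 2)) hA]
  have hle : r0 * (1 - lam) ^ n ≤ r0 :=
    mul_le_of_le_one_right hr0.le (pow_le_one₀ (by linarith) (by linarith))
  have hB : 0 < 1 - δ + δ * lam * (1 - lam) := by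
    have : 0 < δ * lam * (1 - lam) := mul_pos (mul_pos hd0 hl0) (by linarith)
    linarith
  have h3' : r0 * (1 - lam) ^ n * (1 - δ + δ * lam * (1 - lam)) < K :=
    lt_of_le_of_lt (mul_le_mul_of_nonneg_right hle hB.le) h3
  refine E.false_of_odds ⟨hl0, hl1⟩ ⟨hd0, hd1⟩ hr0
    ⟨⟨hl0, hl1⟩, ⟨hd0, hd1⟩, hr0, E.stopAfter_of_lt ⟨hl0, hl1⟩ ⟨hd0, hd1⟩ hr0 hK hstep, hspec⟩
    (hmin _ (by omega)) ?_ h3'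
  -- The bound by `p*` after one more failure follows from the bound by `p*_1`, as `(1 - λ)(1 - δ +
  -- δλ) ≤ 1 - δ + δλ(1 - λ)`.
  refine lt_of_le_of_lt ?_ h3'
  rw [pow_succ, ← mul_assoc, mul_assoc]
  refine mul_le_mul_of_nonneg_left ?_ (hpow n).le
  nlinarith [mul_pos hl0 (sub_pos.2 hd1)]

end Reduced
/-! ### Payoffs -/

@[simp] theorem view_length (i : Player) (f : List Event) : (view i f).length = f.length := by
  induction f with
  | nil => rfl
  | cons e f ih => simp [view, ih]

theorem mover_succ_ne (n : ℕ) : mover (n + 1) ≠ mover n := by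
  unfold mover
  by_cases h : Even n <;> simp [Nat.even_add_one, h]

theorem mover_add_two_mul (n t : ℕ) : mover (n + 2 * t) = mover n := by
  unfold mover
  simp [Nat.even_add]

theorem mover_add_two (n : ℕ) : mover (n + 2) = mover n := mover_add_two_mul n 1

theorem sum_state (F : State → ℝ) : ∑ θ : State, F θ = F .G + F .B := by
  have : (Finset.univ : Finset State) = {.G, .B} := rfl
  rw [this, Finset.sum_pair (by decide)]

theorem sum_event (F : Event → ℝ) : ∑ e : Event, F e = F .safe + F .fail + F .success := by
  have : (Finset.univ : Finset Event) = {.safe, .fail, .success} := rfl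
  rw [this, Finset.sum_insert (by decide), Finset.sum_pair (by decide)]
  ring

namespace Game

variable (Γ : Game)

/-- The expected net payoff of an experiment. -/
def gain (θ : State) : ℝ := Γ.m * Γ.succProb θ - Γ.c

theorem gain_good : Γ.gain .G = Γ.g := by simp [gain, succProb, g]; ring

theorem gain_bad : Γ.gain .B = -Γ.c := by simp [gain, succProb]

variable {Γ} in
theorem succProb_mem (hlam : Γ.lam ∈ Set.Ioo (0 : ℝ) 1) (θ : State) :
    0 ≤ Γ.succProb θ ∧ Γ.succProb θ < 1 := by
  cases θ
  · exact ⟨hlam.1.le, hlam.2⟩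
  · simp [succProb]

theorem sum_moveProb (σ : Profile) (θ : State) (f : List Event) :
    ∑ e : Event, Γ.moveProb σ θ f e = 1 := by
  rw [sum_event]
  simp only [moveProb]
  ring

variable {Γ} in
theorem moveProb_nonneg (hlam : Γ.lam ∈ Set.Ioo (0 : ℝ) 1) (σ : Profile) (θ : State)
    (f : List Event) (e : Event) : 0 ≤ Γ.moveProb σ θ f e := by
  obtain ⟨h0, h1⟩ := succProb_mem hlam θ
  have := (σ (mover f.length) (view (mover f.length) f)).2
  cases e
  · exact sub_nonneg.2 this.2
  · exact mul_nonneg this.1 (by linarith)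
  · exact mul_nonneg this.1 h0

theorem sum_moveProb_reward (σ : Profile) (θ : State) (f : List Event) :
    ∑ e : Event, Γ.moveProb σ θ f e * Γ.reward e =
      (σ (mover f.length) (view (mover f.length) f) : ℝ) * Γ.gain θ := by
  rw [sum_event]
  simp only [moveProb, reward, gain]
  ring

variable {Γ} in
theorem expReward_le (hlam : Γ.lam ∈ Set.Ioo (0 : ℝ) 1) {b : ℝ} (hb : 0 ≤ b) (σ : Profile)
    {θ : State} (hθ : Γ.gain θ ≤ b) (i : Player) (k : ℕ) (f : List Event) :
    Γ.expReward σ θ i k f ≤ b := by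
  induction k generalizing f with
  | zero =>
    rw [expReward]
    split_ifs
    · rw [sum_moveProb_reward]
      have := (σ (mover f.length) (view (mover f.length) f)).2
      nlinarith [this.1, this.2]
    · exact hb
  | succ k ih =>
    rw [expReward]
    calc _ ≤ ∑ e : Event, Γ.moveProb σ θ f e * b :=
          Finset.sum_le_sum fun e _ =>
            mul_le_mul_of_nonneg_left (ih _) (moveProb_nonneg hlam σ θ f e)
      _ = b := by rw [← Finset.sum_mul, sum_moveProb, one_mul]

variable {Γ} in
theorem abs_expReward_le (hlam : Γ.lam ∈ Set.Ioo (0 : ℝ) 1) (σ : Profile) (θ : State)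
    (i : Player) (k : ℕ) (f : List Event) : |Γ.expReward σ θ i k f| ≤ |Γ.gain θ| := by
  induction k generalizing f with
  | zero =>
    rw [expReward]
    split_ifs
    · rw [sum_moveProb_reward, abs_mul]
      have := (σ (mover f.length) (view (mover f.length) f)).2
      rw [abs_of_nonneg this.1]
      exact mul_le_of_le_one_left (abs_nonneg _) this.2
    · simp
  | succ k ih =>
    rw [expReward]
    calc _ ≤ ∑ e : Event, |Γ.moveProb σ θ f e * Γ.expReward σ θ i k (e :: f)| :=
          Finset.abs_sum_le_sum_abs _ _
      _ ≤ ∑ e : Event, Γ.moveProb σ θ f e * |Γ.gain θ| :=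
          Finset.sum_le_sum fun e _ => by
            rw [abs_mul, abs_of_nonneg (moveProb_nonneg hlam σ θ f e)]
            exact mul_le_mul_of_nonneg_left (ih _) (moveProb_nonneg hlam σ θ f e)
      _ = _ := by rw [← Finset.sum_mul, sum_moveProb, one_mul]

variable {Γ} in
theorem summable_expReward (hlam : Γ.lam ∈ Set.Ioo (0 : ℝ) 1) (hδ : Γ.δ ∈ Set.Ioo (0 : ℝ) 1)
    (σ : Profile) (θ : State) (i : Player) (f : List Event) :
    Summable fun t : ℕ => Γ.δ ^ t * Γ.expReward σ θ i (2 * t) f := by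
  refine Summable.of_norm_bounded
    ((summable_geometric_of_lt_one hδ.1.le hδ.2).mul_right |Γ.gain θ|) fun t => ?_
  rw [norm_mul, Real.norm_eq_abs, Real.norm_eq_abs, abs_of_nonneg (pow_nonneg hδ.1.le _)]
  exact mul_le_mul_of_nonneg_left (abs_expReward_le hlam σ θ i _ f) (pow_nonneg hδ.1.le _)

variable {Γ} in
theorem payoffAt_le (hlam : Γ.lam ∈ Set.Ioo (0 : ℝ) 1) (hδ : Γ.δ ∈ Set.Ioo (0 : ℝ) 1) {b : ℝ}
    (hb : 0 ≤ b) (σ : Profile) {θ : State} (hθ : Γ.gain θ ≤ b) (i : Player) (f : List Event) :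
    Γ.payoffAt σ θ i f ≤ b := by
  have h1 : ∑' t : ℕ, Γ.δ ^ t * Γ.expReward σ θ i (2 * t) f ≤ ∑' t : ℕ, Γ.δ ^ t * b :=
    (summable_expReward hlam hδ σ θ i f).tsum_le_tsum
      (fun t => mul_le_mul_of_nonneg_left (expReward_le hlam hb σ hθ i _ f)
        (pow_nonneg hδ.1.le _))
      ((summable_geometric_of_lt_one hδ.1.le hδ.2).mul_right b)
  rw [tsum_mul_right, tsum_geometric_of_lt_one hδ.1.le hδ.2] at h1
  have h2 : 0 < 1 - Γ.δ := by linarith [hδ.2]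
  calc _ ≤ (1 - Γ.δ) * ((1 - Γ.δ)⁻¹ * b) := mul_le_mul_of_nonneg_left h1 h2.le
    _ = b := by field_simp

variable {Γ} in
-- A period consists of two moves, so dropping the first term of the series corresponds to expanding
-- two moves.
theorem payoffAt_eq (hlam : Γ.lam ∈ Set.Ioo (0 : ℝ) 1) (hδ : Γ.δ ∈ Set.Ioo (0 : ℝ) 1)
    (σ : Profile) (θ : State) {i : Player} {f : List Event} (hf : mover f.length = i) :
    Γ.payoffAt σ θ i f = (1 - Γ.δ) * ((σ i (view i f) : ℝ) * Γ.gain θ) +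
      Γ.δ * ∑ e : Event, Γ.moveProb σ θ f e *
        ∑ e' : Event, Γ.moveProb σ θ (e :: f) e' * Γ.payoffAt σ θ i (e' :: e :: f) := by
  have h1 : HasSum (fun t : ℕ => Γ.δ ^ (t + 1) * Γ.expReward σ θ i (2 * (t + 1)) f)
      (Γ.δ * ∑ e : Event, Γ.moveProb σ θ f e * ∑ e' : Event, Γ.moveProb σ θ (e :: f) e' *
        ∑' t : ℕ, Γ.δ ^ t * Γ.expReward σ θ i (2 * t) (e' :: e :: f)) := by
    have h := (hasSum_sum (s := (Finset.univ : Finset Event)) fun e _ =>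
      (hasSum_sum (s := (Finset.univ : Finset Event)) fun e' _ =>
        (summable_expReward hlam hδ σ θ i (e' :: e :: f)).hasSum.mul_left
          (Γ.moveProb σ θ (e :: f) e')).mul_left (Γ.moveProb σ θ f e)).mul_left Γ.δ
    refine h.congr_fun ?_
    intro t
    rw [show 2 * (t + 1) = 2 * t + 1 + 1 by ring]
    simp only [expReward, Finset.mul_sum]
    refine Finset.sum_congr rfl fun e _ => Finset.sum_congr rfl fun e' _ => ?_
    ring
  rw [payoffAt, (summable_expReward hlam hδ σ θ i f).tsum_eq_zero_add, h1.tsum_eq]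
  simp only [payoffAt, expReward, if_pos hf, sum_moveProb_reward]
  rw [hf, pow_zero, one_mul, mul_add]
  congr 1
  simp only [Finset.mul_sum]
  refine Finset.sum_congr rfl fun e _ => Finset.sum_congr rfl fun e' _ => ?_
  ring

theorem moveProb_congr {σ σ' : Profile} {f : List Event}
    (h : σ (mover f.length) (view (mover f.length) f) =
      σ' (mover f.length) (view (mover f.length) f)) (θ : State) (e : Event) :
    Γ.moveProb σ θ f e = Γ.moveProb σ' θ f e := by
  cases e <;> simp only [moveProb, h]

theorem expReward_congr {σ σ' : Profile} {n : ℕ}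
    (h : ∀ j s, n ≤ s.length → σ j s = σ' j s) (θ : State) (i : Player) (k : ℕ)
    {f : List Event} (hf : n ≤ f.length) : Γ.expReward σ θ i k f = Γ.expReward σ' θ i k f := by
  have hm : ∀ e, Γ.moveProb σ θ f e = Γ.moveProb σ' θ f e :=
    fun e => Γ.moveProb_congr (h _ _ (by simpa using hf)) θ e
  induction k generalizing f with
  | zero => simp only [expReward, hm]
  | succ k ih =>
    simp only [expReward, hm]
    refine Finset.sum_congr rfl fun e _ => ?_
    have hf' : n ≤ (e :: f).length := by simp; omega
    rw [ih hf' fun e' => Γ.moveProb_congr (h _ _ (by simpa using hf')) θ e']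

theorem payoffAt_congr {σ σ' : Profile} {n : ℕ}
    (h : ∀ j s, n ≤ s.length → σ j s = σ' j s) (θ : State) (i : Player)
    {f : List Event} (hf : n ≤ f.length) : Γ.payoffAt σ θ i f = Γ.payoffAt σ' θ i f := by
  simp only [payoffAt, Γ.expReward_congr h θ i _ hf]

theorem expReward_const {σ : Profile} {i : Player} {u : unitInterval} (h : ∀ s, σ i s = u)
    (θ : State) (k : ℕ) (f : List Event) :
    Γ.expReward σ θ i k f = if mover (f.length + k) = i then (u : ℝ) * Γ.gain θ else 0 := by
  induction k generalizing f with
  | zero =>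
    rw [expReward, sum_moveProb_reward, add_zero]
    split_ifs with hi
    · rw [hi, h]
    · rfl
  | succ k ih =>
    have e : ∀ x : Event, (x :: f).length + k = f.length + (k + 1) := fun x => by simp; ring
    simp only [expReward, ih, e]
    rw [← Finset.sum_mul, sum_moveProb, one_mul]

variable {Γ} in
-- Using one arm forever makes the other player's strategy irrelevant; these deviations give lower
-- bounds for equilibrium payoffs.
theorem payoffAt_const (hδ : Γ.δ ∈ Set.Ioo (0 : ℝ) 1) {σ : Profile} {i : Player}
    {u : unitInterval} (h : ∀ s, σ i s = u) (θ : State) {f : List Event}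
    (hf : mover f.length = i) : Γ.payoffAt σ θ i f = (u : ℝ) * Γ.gain θ := by
  have h2 : 1 - Γ.δ ≠ 0 := by linarith [hδ.2]
  simp only [payoffAt, Γ.expReward_const h, mover_add_two_mul, hf, if_true]
  rw [tsum_mul_right, tsum_geometric_of_lt_one hδ.1.le hδ.2, mul_inv_cancel_left₀ h2]

end Game
/-! ### Beliefs -/

theorem mem_consistentWith {i : Player} {s : List Signal} {f : List Event} :
    f ∈ consistentWith i s ↔ view i f = s := by
  simp only [consistentWith, Finset.mem_filter, mem_histories, and_iff_right_iff_imp]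
  rintro rfl
  simp

theorem sum_histories_succ (n : ℕ) (F : List Event → ℝ) :
    ∑ f ∈ histories (n + 1), F f = ∑ f ∈ histories n, ∑ e : Event, F (e :: f) := by
  rw [histories, Finset.sum_biUnion]
  · refine Finset.sum_congr rfl fun f _ => ?_
    rw [Finset.sum_image fun _ _ _ _ h => (List.cons.inj h).1]
  · intro f _ f' _ hne
    refine Finset.disjoint_left.2 fun x hx hx' => hne ?_
    obtain ⟨e, _, rfl⟩ := Finset.mem_image.1 hx
    obtain ⟨e', _, h⟩ := Finset.mem_image.1 hx'
    exact (List.cons.inj h).2.symm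

theorem sum_consistentWith_cons (i : Player) (x : Signal) (s : List Signal)
    (F : List Event → ℝ) :
    ∑ f ∈ consistentWith i (x :: s), F f = ∑ f ∈ consistentWith i s, ∑ e : Event,
      if (if mover s.length = i then Signal.own e else Signal.other e.arm) = x
      then F (e :: f) else 0 := by
  rw [consistentWith, consistentWith, Finset.sum_filter, Finset.sum_filter, List.length_cons,
    sum_histories_succ]
  refine Finset.sum_congr rfl fun f hf => ?_
  rw [mem_histories] at hf
  by_cases h : view i f = s
  · simp [view, h, hf]
  · simp [view, h]

theorem sum_consistentWith_period {i : Player} {s : List Signal} (hs : mover s.length = i)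
    (e : Event) (y : Arm) (F : List Event → ℝ) :
    ∑ f ∈ consistentWith i (.other y :: .own e :: s), F f =
      ∑ f ∈ consistentWith i s, ∑ e' : Event, if e'.arm = y then F (e' :: e :: f) else 0 := by
  have h1 : mover (Signal.own e :: s).length ≠ i := by
    rw [← hs]; exact mover_succ_ne _
  rw [sum_consistentWith_cons, sum_consistentWith_cons]
  simp only [if_neg h1, if_pos hs, Signal.own.injEq, Signal.other.injEq]
  refine Finset.sum_congr rfl fun f _ => ?_
  rw [Finset.sum_ite_eq' Finset.univ e, if_pos (Finset.mem_univ _)]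

theorem view_period {i : Player} {f : List Event} (hf : mover f.length = i) (e e' : Event) :
    view i (e' :: e :: f) = .other e'.arm :: .own e :: view i f := by
  have h1 : mover (f.length + 1) ≠ i := by rw [← hf]; exact mover_succ_ne _
  simp [view, hf, h1]

namespace Game

variable (Γ : Game)

/-- The probability of an outcome in a given state, if the corresponding arm is chosen. -/
def outProb (θ : State) : Event → ℝ
  | .safe => 1
  | .fail => 1 - Γ.succProb θ
  | .success => Γ.succProb θ

/-- The probability of the choice underlying an event, if the risky arm is chosen with
probability `u`. -/
def _root_.Bandit.actProb (u : ℝ) : Event → ℝ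
  | .safe => 1 - u
  | .fail => u
  | .success => u

theorem moveProb_eq (σ : Profile) (θ : State) (f : List Event) (e : Event) :
    Γ.moveProb σ θ f e =
      actProb (σ (mover f.length) (view (mover f.length) f) : ℝ) e * Γ.outProb θ e := by
  cases e <;> simp [moveProb, actProb, outProb]

theorem outProb_nonneg {Γ : Game} (hlam : Γ.lam ∈ Set.Ioo (0 : ℝ) 1) (θ : State) (e : Event) :
    0 ≤ Γ.outProb θ e := by
  obtain ⟨h0, h1⟩ := succProb_mem hlam θ
  cases e <;> simp only [outProb] <;> linarith

theorem pathProb_nonneg {Γ : Game} (hlam : Γ.lam ∈ Set.Ioo (0 : ℝ) 1) (σ : Profile) (θ : State)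
    (f : List Event) : 0 ≤ Γ.pathProb σ θ f := by
  induction f with
  | nil => exact zero_le_one
  | cons e f ih => exact mul_nonneg ih (moveProb_nonneg hlam σ θ f e)

theorem pathProb_good_pos {Γ : Game} (hlam : Γ.lam ∈ Set.Ioo (0 : ℝ) 1) {τ : Profile}
    (hτ : CompletelyMixed τ) (f : List Event) : 0 < Γ.pathProb τ .G f := by
  obtain ⟨h0, h1⟩ := hlam
  induction f with
  | nil => exact zero_lt_one
  | cons e f ih =>
    obtain ⟨h2, h3⟩ := hτ f
    refine mul_pos ih ?_
    cases e <;> simp only [moveProb, succProb]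
    · linarith
    · exact mul_pos h2 (by linarith)
    · exact mul_pos h2 h0

theorem pathProb_bad_eq_zero (σ : Profile) {f : List Event} (hf : Event.success ∈ f) :
    Γ.pathProb σ .B f = 0 := by
  induction f with
  | nil => simp at hf
  | cons e f ih =>
    rcases List.mem_cons.1 hf with rfl | h
    · simp [pathProb, moveProb, succProb]
    · simp [pathProb, ih h]

theorem pathProb_allFail (σ : Profile) (h : List Arm) :
    Γ.pathProb σ .G (allFail h) = Γ.pathProb σ .B (allFail h) * (1 - Γ.lam) ^ numExp h := by
  induction h with
  | nil => simp [allFail, pathProb]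
  | cons a h ih =>
    cases a
    · simp [allFail, pathProb, moveProb, ih]
      ring
    · simp [allFail, pathProb, moveProb, succProb, ih, pow_succ]
      ring

theorem prior_pos {Γ : Game} (hp : Γ.p0 ∈ Set.Ioo (0 : ℝ) 1) (θ : State) : 0 < Γ.prior θ := by
  cases θ <;> simp only [prior] <;> linarith [hp.1, hp.2]

/-- The probability of the private history `s`. -/
def viewProb (τ : Profile) (i : Player) (s : List Signal) : ℝ :=
  ∑ θ : State, ∑ f ∈ consistentWith i s, Γ.prior θ * Γ.pathProb τ θ f

theorem viewProb_pos {Γ : Game} (hlam : Γ.lam ∈ Set.Ioo (0 : ℝ) 1)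
    (hp : Γ.p0 ∈ Set.Ioo (0 : ℝ) 1) {τ : Profile} (hτ : CompletelyMixed τ) (i : Player)
    (f : List Event) : 0 < Γ.viewProb τ i (view i f) := by
  have hn : ∀ θ f', 0 ≤ Γ.prior θ * Γ.pathProb τ θ f' := fun θ f' =>
    mul_nonneg (prior_pos hp θ).le (pathProb_nonneg hlam τ θ f')
  rw [viewProb, sum_state]
  refine add_pos_of_pos_of_nonneg ?_ (Finset.sum_nonneg fun _ _ => hn _ _)
  exact Finset.sum_pos' (fun _ _ => hn _ _)
    ⟨f, mem_consistentWith.2 rfl, mul_pos (prior_pos hp _) (pathProb_good_pos hlam hτ f)⟩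

/-- The probability of the choice `y` of the other player, after an own event `e`. The
probability of the own choice that underlies `e` is left out. -/
def reach (σ : Profile) (β : State → List Event → ℝ) (i : Player) (s : List Signal) (e : Event)
    (y : Arm) : ℝ :=
  ∑ θ : State, ∑ f ∈ consistentWith i s, β θ f * Γ.outProb θ e *
    ∑ e' : Event, if e'.arm = y then Γ.moveProb σ θ (e :: f) e' else 0

/-- The probability of the own choice is the same on all histories in the information set, so it
cancels. The product form survives the limit of mixed profiles, also after deviations and where
`reach` vanishes. -/
theorem bayes_step {Γ : Game} (hlam : Γ.lam ∈ Set.Ioo (0 : ℝ) 1)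
    (hp : Γ.p0 ∈ Set.Ioo (0 : ℝ) 1) {τ : Profile} (hτ : CompletelyMixed τ) {i : Player}
    {f : List Event} (hf : mover f.length = i) (θ : State) (e e' : Event) :
    Γ.reach τ (Γ.bayes τ i (view i f)) i (view i f) e e'.arm *
        Γ.bayes τ i (.other e'.arm :: .own e :: view i f) θ (e' :: e :: f) =
      Γ.bayes τ i (view i f) θ f * Γ.outProb θ e * Γ.moveProb τ θ (e :: f) e' := by
  have hZ := (viewProb_pos hlam hp hτ i f).ne'
  have hZ' := (viewProb_pos hlam hp hτ i (e' :: e :: f)).ne'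
  rw [view_period hf] at hZ'
  set s := view i f with hs
  have hsl : mover s.length = i := by rw [hs, view_length, hf]
  have hb : ∀ θ f', view i f' = s →
      Γ.bayes τ i s θ f' = Γ.prior θ * Γ.pathProb τ θ f' / Γ.viewProb τ i s := by
    intro θ f' h
    rw [bayes, if_pos h, viewProb]
  have hb' : Γ.bayes τ i (.other e'.arm :: .own e :: s) θ (e' :: e :: f) =
      Γ.prior θ * Γ.pathProb τ θ (e' :: e :: f) /
        Γ.viewProb τ i (.other e'.arm :: .own e :: s) := by
    rw [bayes, if_pos (by rw [view_period hf]), viewProb]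
  have hm : ∀ θ f', view i f' = s →
      Γ.moveProb τ θ f' e = actProb (τ i s : ℝ) e * Γ.outProb θ e := by
    intro θ f' h
    have : f'.length = s.length := by rw [← h, view_length]
    rw [moveProb_eq, this, hsl, h]
  have hV : Γ.viewProb τ i (.other e'.arm :: .own e :: s) = actProb (τ i s : ℝ) e *
      (Γ.reach τ (Γ.bayes τ i s) i s e e'.arm * Γ.viewProb τ i s) := by
    generalize Γ.viewProb τ i s = Z at *
    simp only [viewProb, reach]
    rw [Finset.sum_mul, Finset.mul_sum]
    refine Finset.sum_congr rfl fun θ _ => ?_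
    rw [sum_consistentWith_period hsl, Finset.sum_mul, Finset.mul_sum]
    refine Finset.sum_congr rfl fun f' hf' => ?_
    have hf'' := mem_consistentWith.1 hf'
    rw [hb θ f' hf'', Finset.mul_sum, Finset.sum_mul, Finset.mul_sum]
    refine Finset.sum_congr rfl fun e'' _ => ?_
    split_ifs
    · simp only [pathProb]
      rw [hm θ f' hf'']
      field_simp
    · simp
  rw [hb', hb θ f rfl]
  simp only [pathProb]
  rw [hm θ f rfl]
  rw [hV] at hZ' ⊢
  have h1 : actProb (τ i s : ℝ) e ≠ 0 := fun h => hZ' (by simp [h])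
  have h2 : Γ.reach τ (Γ.bayes τ i s) i s e e'.arm ≠ 0 := fun h => hZ' (by simp [h])
  field_simp

theorem tendsto_moveProb {τ : ℕ → Profile} {σ : Profile} {f : List Event}
    (h : Filter.Tendsto (fun n => (τ n (mover f.length) (view (mover f.length) f) : ℝ))
      Filter.atTop (nhds (σ (mover f.length) (view (mover f.length) f) : ℝ)))
    (θ : State) (e : Event) :
    Filter.Tendsto (fun n => Γ.moveProb (τ n) θ f e) Filter.atTop
      (nhds (Γ.moveProb σ θ f e)) := by
  cases e
  · exact h.const_sub 1
  · exact h.mul_const _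
  · exact h.mul_const _

variable {Γ} {σ : Profile} {π : Beliefs}

/-- Bayes' rule over one period, starting with a choice of player `i`. -/
theorem Consistent.step (hc : Γ.Consistent σ π) (hlam : Γ.lam ∈ Set.Ioo (0 : ℝ) 1)
    (hp : Γ.p0 ∈ Set.Ioo (0 : ℝ) 1) {i : Player} {f : List Event} (hf : mover f.length = i)
    (θ : State) (e e' : Event) :
    Γ.reach σ (π i (view i f)) i (view i f) e e'.arm *
        π i (.other e'.arm :: .own e :: view i f) θ (e' :: e :: f) =
      π i (view i f) θ f * Γ.outProb θ e * Γ.moveProb σ θ (e :: f) e' := by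
  obtain ⟨τ, hτ, hσ, hπ⟩ := hc
  have hm := fun f => Γ.tendsto_moveProb (hσ f)
  have h1 : Filter.Tendsto (fun n => Γ.reach (τ n) (Γ.bayes (τ n) i (view i f)) i (view i f) e
      e'.arm) Filter.atTop (nhds (Γ.reach σ (π i (view i f)) i (view i f) e e'.arm)) := by
    refine tendsto_finsetSum _ fun θ _ => tendsto_finsetSum _ fun f' _ => ?_
    refine ((hπ i f θ f').mul_const _).mul (tendsto_finsetSum _ fun e'' _ => ?_)
    split_ifs
    · exact hm _ θ e''
    · exact tendsto_const_nhds
  have h2 := hπ i (e' :: e :: f) θ (e' :: e :: f)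
  rw [view_period hf] at h2
  have h3 := ((hπ i f θ f).mul_const (Γ.outProb θ e)).mul (hm (e :: f) θ e')
  exact tendsto_nhds_unique
    ((h1.mul h2).congr fun n => bayes_step hlam hp (hτ n) hf θ e e') h3

theorem Consistent.bad_eq_zero (hc : Γ.Consistent σ π) (i : Player) (f : List Event)
    {f' : List Event} (hf' : Event.success ∈ f') : π i (view i f) .B f' = 0 := by
  obtain ⟨τ, hτ, hσ, hπ⟩ := hc
  refine tendsto_nhds_unique (hπ i f .B f') (tendsto_const_nhds.congr fun n => ?_)
  simp [bayes, Γ.pathProb_bad_eq_zero (τ n) hf']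

/-- Choice probabilities along a path do not depend on the state, so for each mixed profile the
likelihood ratio comes from the failures alone. Cross-multiplied, it passes to the limit off the
path too. -/
theorem Consistent.allFail (hc : Γ.Consistent σ π) (i : Player) (h : List Arm) :
    π i (view i (allFail h)) .G (allFail h) * (1 - Γ.p0) =
      π i (view i (allFail h)) .B (allFail h) * (Γ.p0 * (1 - Γ.lam) ^ numExp h) := by
  obtain ⟨τ, hτ, hσ, hπ⟩ := hc
  refine tendsto_nhds_unique ((hπ i (Bandit.allFail h) .G (Bandit.allFail h)).mul_const _)
    (((hπ i (Bandit.allFail h) .B (Bandit.allFail h)).mul_const _).congr fun n => ?_)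
  simp only [bayes, if_true, Γ.pathProb_allFail (τ n) h, prior]
  ring

end Game
/-! ### Values in equilibrium -/

/-- The probability that player `i` assigns to the bad state. -/
def badBelief (π : Beliefs) (i : Player) (s : List Signal) : ℝ :=
  ∑ f ∈ consistentWith i s, π i s .B f

/-- The probability that player `i` assigns to the good state. -/
def goodBelief (π : Beliefs) (i : Player) (s : List Signal) : ℝ :=
  ∑ f ∈ consistentWith i s, π i s .G f

theorem IsBeliefSystem.add_eq_one {π : Beliefs} (hπ : IsBeliefSystem π) (i : Player)
    (f : List Event) : goodBelief π i (view i f) + badBelief π i (view i f) = 1 := by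
  have := (hπ i f).2.2
  rwa [sum_state] at this

theorem IsBeliefSystem.bad_nonneg {π : Beliefs} (hπ : IsBeliefSystem π) (i : Player)
    (f : List Event) : 0 ≤ badBelief π i (view i f) :=
  Finset.sum_nonneg fun f' _ => (hπ i f).1 .B f'

namespace Game

variable (Γ : Game)

/-- The contribution to the payoff of the periods after the current one, if the own event in the
current period is `e`, weighted by the probability of the corresponding outcome. -/
def afterEvent (σ : Profile) (π : Beliefs) (i : Player) (s : List Signal) (e : Event) : ℝ :=
  Γ.reach σ (π i s) i s e .S * Γ.contPayoff π σ i (.other .S :: .own e :: s) +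
    Γ.reach σ (π i s) i s e .R * Γ.contPayoff π σ i (.other .R :: .own e :: s)

/-- The payoff from choosing the safe arm now and following `σ` afterwards. -/
def safePayoff (σ : Profile) (π : Beliefs) (i : Player) (s : List Signal) : ℝ :=
  Γ.δ * Γ.afterEvent σ π i s .safe

/-- The payoff from choosing the risky arm now and following `σ` afterwards. -/
def riskyPayoff (σ : Profile) (π : Beliefs) (i : Player) (s : List Signal) : ℝ :=
  (1 - Γ.δ) * (goodBelief π i s * Γ.g - badBelief π i s * Γ.c) +
    Γ.δ * (Γ.afterEvent σ π i s .fail + Γ.afterEvent σ π i s .success)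

variable {Γ} {σ : Profile} {π : Beliefs}

theorem contPayoff_eq_of_payoffAt {i : Player} {s : List Signal} {x : State → ℝ} {σ' : Profile}
    (h : ∀ θ, ∀ f ∈ consistentWith i s, Γ.payoffAt σ' θ i f = x θ) :
    Γ.contPayoff π σ' i s = goodBelief π i s * x .G + badBelief π i s * x .B := by
  rw [contPayoff, sum_state, goodBelief, badBelief, Finset.sum_mul, Finset.sum_mul]
  congr 1
  all_goals exact Finset.sum_congr rfl fun f hf => by rw [h _ f hf]

theorem contPayoff_le (hlam : Γ.lam ∈ Set.Ioo (0 : ℝ) 1) (hδ : Γ.δ ∈ Set.Ioo (0 : ℝ) 1)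
    (hc : 0 < Γ.c) (hg : 0 < Γ.g) (hπ : IsBeliefSystem π) (i : Player) (f : List Event) :
    Γ.contPayoff π σ i (view i f) ≤ goodBelief π i (view i f) * Γ.g := by
  rw [contPayoff, sum_state, goodBelief, Finset.sum_mul]
  have h1 : ∑ f' ∈ consistentWith i (view i f), π i (view i f) .B f' * Γ.payoffAt σ .B i f' ≤ 0 :=
    Finset.sum_nonpos fun f' _ => mul_nonpos_of_nonneg_of_nonpos ((hπ i f).1 _ _)
      (payoffAt_le hlam hδ le_rfl σ (by rw [gain_bad]; linarith) i f')
  have h2 : ∑ f' ∈ consistentWith i (view i f), π i (view i f) .G f' * Γ.payoffAt σ .G i f' ≤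
      ∑ f' ∈ consistentWith i (view i f), π i (view i f) .G f' * Γ.g :=
    Finset.sum_le_sum fun f' _ => mul_le_mul_of_nonneg_left
      (payoffAt_le hlam hδ hg.le σ (by rw [gain_good]) i f') ((hπ i f).1 _ _)
  linarith

/-- Bayes' rule turns the average over current beliefs into payoffs at the two next private
histories, weighted by `reach`. -/
theorem Consistent.sum_afterEvent (hcon : Γ.Consistent σ π) (hlam : Γ.lam ∈ Set.Ioo (0 : ℝ) 1)
    (hp : Γ.p0 ∈ Set.Ioo (0 : ℝ) 1) {i : Player} {f : List Event} (hf : mover f.length = i)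
    (e : Event) :
    ∑ θ : State, ∑ f' ∈ consistentWith i (view i f), π i (view i f) θ f' * (Γ.outProb θ e *
      ∑ e' : Event, Γ.moveProb σ θ (e :: f') e' * Γ.payoffAt σ θ i (e' :: e :: f')) =
      Γ.afterEvent σ π i (view i f) e := by
  have hsl : mover (view i f).length = i := by rw [view_length, hf]
  have key : ∀ y : Arm, Γ.reach σ (π i (view i f)) i (view i f) e y *
      Γ.contPayoff π σ i (.other y :: .own e :: view i f) =
      ∑ θ : State, ∑ f' ∈ consistentWith i (view i f), π i (view i f) θ f' * (Γ.outProb θ e *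
      ∑ e' : Event, if e'.arm = y then
        Γ.moveProb σ θ (e :: f') e' * Γ.payoffAt σ θ i (e' :: e :: f') else 0) := by
    intro y
    rw [contPayoff, Finset.mul_sum]
    refine Finset.sum_congr rfl fun θ _ => ?_
    rw [sum_consistentWith_period hsl, Finset.mul_sum]
    refine Finset.sum_congr rfl fun f' hf' => ?_
    have hv := mem_consistentWith.1 hf'
    have hl : mover f'.length = i := by
      rw [← view_length i f', hv, view_length, hf]
    rw [Finset.mul_sum, Finset.mul_sum, Finset.mul_sum]
    refine Finset.sum_congr rfl fun e' _ => ?_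
    split_ifs with hy
    · have := hcon.step hlam hp hl θ e e'
      rw [hv, hy] at this
      rw [← mul_assoc, this]
      ring
    · simp
  rw [afterEvent, key, key, ← Finset.sum_add_distrib]
  refine Finset.sum_congr rfl fun θ _ => ?_
  rw [← Finset.sum_add_distrib]
  refine Finset.sum_congr rfl fun f' _ => ?_
  rw [← mul_add, ← mul_add, ← Finset.sum_add_distrib]
  congr 2
  refine Finset.sum_congr rfl fun e' _ => ?_
  cases e' <;> simp [Event.arm]

/-- The payoff from a deviation in the current period only. -/
theorem Consistent.contPayoff_update (hcon : Γ.Consistent σ π)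
    (hlam : Γ.lam ∈ Set.Ioo (0 : ℝ) 1) (hδ : Γ.δ ∈ Set.Ioo (0 : ℝ) 1)
    (hp : Γ.p0 ∈ Set.Ioo (0 : ℝ) 1) {i : Player} {f : List Event} (hf : mover f.length = i)
    (u : unitInterval) :
    Γ.contPayoff π (Function.update σ i (Function.update (σ i) (view i f) u)) i (view i f) =
      (1 - (u : ℝ)) * Γ.safePayoff σ π i (view i f) +
        (u : ℝ) * Γ.riskyPayoff σ π i (view i f) := by
  set σ' := Function.update σ i (Function.update (σ i) (view i f) u) with hσ'
  -- The deviation affects only a private history of the current length, so play from the next move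
  -- on is unchanged.
  have hcongr : ∀ j s, f.length + 1 ≤ s.length → σ' j s = σ j s := by
    intro j s hs
    rw [hσ']
    by_cases hj : j = i
    · subst hj
      rw [Function.update_self, Function.update_of_ne]
      rintro rfl
      simp at hs
    · rw [Function.update_of_ne hj]
  have hu : σ' i (view i f) = u := by rw [hσ', Function.update_self, Function.update_self]
  obtain ⟨N, hN⟩ : ∃ N : State → List Event → Event → ℝ, ∀ θ f' e, Γ.outProb θ e *
      ∑ e' : Event, Γ.moveProb σ θ (e :: f') e' * Γ.payoffAt σ θ i (e' :: e :: f') = N θ f' e :=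
    ⟨_, fun _ _ _ => rfl⟩
  have hpay : ∀ θ, ∀ f' ∈ consistentWith i (view i f), Γ.payoffAt σ' θ i f' =
      (1 - (u : ℝ)) * (Γ.δ * N θ f' .safe) + (u : ℝ) *
        ((1 - Γ.δ) * Γ.gain θ + Γ.δ * (N θ f' .fail + N θ f' .success)) := by
    intro θ f' hf'
    have hv := mem_consistentWith.1 hf'
    have hlen : f'.length = f.length := by rw [← view_length i f', hv, view_length]
    have hl : mover f'.length = i := by rw [hlen, hf]
    have h2 : ∀ e, ∑ e' : Event, Γ.moveProb σ' θ (e :: f') e' *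
        Γ.payoffAt σ' θ i (e' :: e :: f') = ∑ e' : Event, Γ.moveProb σ θ (e :: f') e' *
        Γ.payoffAt σ θ i (e' :: e :: f') := fun e => Finset.sum_congr rfl fun e' _ => by
      rw [Γ.moveProb_congr (hcongr _ _ (by simp [hlen])),
        Γ.payoffAt_congr hcongr θ i (by simp [hlen])]
    rw [payoffAt_eq hlam hδ σ' θ hl, hv, hu]
    simp only [h2]
    rw [sum_event]
    simp only [moveProb_eq Γ σ' θ f', hl, hv, hu, actProb, ← hN]
    ring
  have e1 := hcon.sum_afterEvent hlam hp hf .safe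
  have e2 := hcon.sum_afterEvent hlam hp hf .fail
  have e3 := hcon.sum_afterEvent hlam hp hf .success
  simp only [hN] at e1 e2 e3
  have e4 : ∑ θ : State, ∑ f' ∈ consistentWith i (view i f), π i (view i f) θ f' * Γ.gain θ =
      goodBelief π i (view i f) * Γ.g - badBelief π i (view i f) * Γ.c := by
    rw [sum_state, gain_good, gain_bad, ← Finset.sum_mul, ← Finset.sum_mul, goodBelief, badBelief]
    ring
  rw [safePayoff, riskyPayoff, ← e1, ← e2, ← e3, ← e4, contPayoff]
  simp only [Finset.mul_sum, ← Finset.sum_add_distrib]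
  refine Finset.sum_congr rfl fun θ _ => Finset.sum_congr rfl fun f' hf' => ?_
  rw [hpay θ f' hf']
  ring

theorem reach_nonneg (hlam : Γ.lam ∈ Set.Ioo (0 : ℝ) 1) (hπ : IsBeliefSystem π) (i : Player)
    (f : List Event) (e : Event) (y : Arm) :
    0 ≤ Γ.reach σ (π i (view i f)) i (view i f) e y := by
  refine Finset.sum_nonneg fun θ _ => Finset.sum_nonneg fun f' _ => ?_
  refine mul_nonneg (mul_nonneg ((hπ i f).1 _ _) (outProb_nonneg hlam _ _))
    (Finset.sum_nonneg fun e' _ => ?_)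
  split_ifs
  · exact moveProb_nonneg hlam _ _ _ _
  · exact le_rfl

theorem reach_add (i : Player) (s : List Signal) (e : Event) :
    Γ.reach σ (π i s) i s e .S + Γ.reach σ (π i s) i s e .R =
      goodBelief π i s * Γ.outProb .G e + badBelief π i s * Γ.outProb .B e := by
  have h : ∀ θ f, (∑ e' : Event, if e'.arm = .S then Γ.moveProb σ θ f e' else 0) +
      (∑ e' : Event, if e'.arm = .R then Γ.moveProb σ θ f e' else 0) = 1 := by
    intro θ f
    rw [← Γ.sum_moveProb σ θ f, sum_event, sum_event, sum_event]
    simp [Event.arm]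
    ring
  simp only [reach]
  rw [← Finset.sum_add_distrib]
  simp only [← Finset.sum_add_distrib, ← mul_add, h, mul_one]
  rw [sum_state, ← Finset.sum_mul, ← Finset.sum_mul, goodBelief, badBelief]

/-- A pure reasonable sequential equilibrium, with the restrictions on the parameters. -/
structure PureEquilibrium (Γ : Game) (σ : Profile) (π : Beliefs) : Prop where
  hlam : Γ.lam ∈ Set.Ioo (0 : ℝ) 1
  hδ : Γ.δ ∈ Set.Ioo (0 : ℝ) 1
  hc : 0 < Γ.c
  hg : 0 < Γ.g
  hp : Γ.p0 ∈ Set.Ioo (0 : ℝ) 1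
  isReasonable : Γ.IsReasonableSE σ π
  isPure : IsPure σ

/-! ### Consequences of optimality -/

namespace PureEquilibrium

variable {i : Player} {f : List Event}

theorem beliefs (E : PureEquilibrium Γ σ π) : IsBeliefSystem π := E.isReasonable.1.1

theorem rational (E : PureEquilibrium Γ σ π) : Γ.SequentiallyRational σ π := E.isReasonable.1.2.1

theorem consistent (E : PureEquilibrium Γ σ π) : Γ.Consistent σ π := E.isReasonable.1.2.2

theorem deviation_le (E : PureEquilibrium Γ σ π) (hf : mover f.length = i) (τ : Strategy) :
    Γ.contPayoff π (Function.update σ i τ) i (view i f) ≤ Γ.contPayoff π σ i (view i f) := by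
  subst hf
  exact E.rational f τ

theorem safePayoff_le (E : PureEquilibrium Γ σ π) (hf : mover f.length = i) :
    Γ.safePayoff σ π i (view i f) ≤ Γ.contPayoff π σ i (view i f) := by
  have h := E.deviation_le hf (Function.update (σ i) (view i f) 0)
  rw [E.consistent.contPayoff_update E.hlam E.hδ E.hp hf] at h
  simpa using h

theorem riskyPayoff_le (E : PureEquilibrium Γ σ π) (hf : mover f.length = i) :
    Γ.riskyPayoff σ π i (view i f) ≤ Γ.contPayoff π σ i (view i f) := by
  have h := E.deviation_le hf (Function.update (σ i) (view i f) 1)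
  rw [E.consistent.contPayoff_update E.hlam E.hδ E.hp hf] at h
  simpa using h

theorem contPayoff_eq (E : PureEquilibrium Γ σ π) (hf : mover f.length = i) :
    Γ.contPayoff π σ i (view i f) =
      (1 - (σ i (view i f) : ℝ)) * Γ.safePayoff σ π i (view i f) +
        (σ i (view i f) : ℝ) * Γ.riskyPayoff σ π i (view i f) := by
  have h := E.consistent.contPayoff_update E.hlam E.hδ E.hp hf (σ i (view i f))
  rwa [Function.update_eq_self, Function.update_eq_self] at h

theorem contPayoff_nonneg (E : PureEquilibrium Γ σ π) (hf : mover f.length = i) :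
    0 ≤ Γ.contPayoff π σ i (view i f) := by
  have h := E.deviation_le hf fun _ => 0
  rw [contPayoff_eq_of_payoffAt (x := fun _ => 0)] at h
  · simpa using h
  · intro θ f' hf'
    have hl : mover f'.length = i := by
      rw [← view_length i f', mem_consistentWith.1 hf', view_length, hf]
    rw [payoffAt_const E.hδ (u := 0) (fun s => by rw [Function.update_self]) θ hl]
    simp

theorem le_contPayoff (E : PureEquilibrium Γ σ π) (hf : mover f.length = i) :
    goodBelief π i (view i f) * Γ.g - badBelief π i (view i f) * Γ.c ≤
      Γ.contPayoff π σ i (view i f) := by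
  have h := E.deviation_le hf fun _ => 1
  rw [contPayoff_eq_of_payoffAt (x := Γ.gain), gain_good, gain_bad] at h
  · linarith
  · intro θ f' hf'
    have hl : mover f'.length = i := by
      rw [← view_length i f', mem_consistentWith.1 hf', view_length, hf]
    rw [payoffAt_const E.hδ (u := 1) (fun s => by rw [Function.update_self]) θ hl]
    simp

theorem contPayoff_eq_gain (E : PureEquilibrium Γ σ π) (hf : mover f.length = i)
    (hb : badBelief π i (view i f) = 0) : Γ.contPayoff π σ i (view i f) = Γ.g := by
  have h1 := E.beliefs.add_eq_one i f
  have h2 := E.le_contPayoff hf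
  have h3 := contPayoff_le (σ := σ) E.hlam E.hδ E.hc E.hg E.beliefs i f
  have h4 : goodBelief π i (view i f) = 1 := by linarith
  rw [h4] at h2 h3
  rw [hb] at h2
  linarith

/-- Using the risky arm forever yields `g`, whereas choosing `S` now yields at most `δ g`. -/
theorem eq_one_of_bad_eq_zero (E : PureEquilibrium Γ σ π) (hf : mover f.length = i)
    (hb : badBelief π i (view i f) = 0) : σ i (view i f) = 1 := by
  subst hf
  refine (E.isPure f).resolve_left fun h0 => ?_
  have h1 := E.contPayoff_eq rfl (f := f)
  rw [E.contPayoff_eq_gain rfl hb, h0, safePayoff, afterEvent] at h1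
  have hle : ∀ e' : Event, Γ.contPayoff π σ (mover f.length)
      (.other e'.arm :: .own .safe :: view (mover f.length) f) ≤ Γ.g := by
    intro e'
    have h2 := contPayoff_le (σ := σ) E.hlam E.hδ E.hc E.hg E.beliefs (mover f.length)
      (e' :: .safe :: f)
    have h3 := E.beliefs.add_eq_one (mover f.length) (e' :: .safe :: f)
    have h4 := E.beliefs.bad_nonneg (mover f.length) (e' :: .safe :: f)
    rw [view_period rfl] at h2 h3 h4
    nlinarith [E.hg]
  have hS := mul_le_mul_of_nonneg_left (hle .safe)
    (reach_nonneg (σ := σ) E.hlam E.beliefs (mover f.length) f .safe .S)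
  have hR := mul_le_mul_of_nonneg_left (hle .fail)
    (reach_nonneg (σ := σ) E.hlam E.beliefs (mover f.length) f .safe .R)
  have hs := reach_add (Γ := Γ) (σ := σ) (π := π) (mover f.length) (view (mover f.length) f) .safe
  simp only [outProb, mul_one, E.beliefs.add_eq_one] at hs
  simp only [Event.arm] at hS hR
  have hsum := mul_le_mul_of_nonneg_left (add_le_add hS hR) E.hδ.1.le
  rw [← add_mul, hs] at hsum
  have := mul_lt_mul_of_pos_right E.hδ.2 E.hg
  simp only [Set.Icc.coe_zero] at h1
  linarith

end PureEquilibrium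

end Game
/-! ### Reduction to the reduced game -/

/-- The event that belongs to a choice if experiments fail. -/
def failEvent : Arm → Event
  | .S => .safe
  | .R => .fail

@[simp] theorem arm_failEvent (a : Arm) : (failEvent a).arm = a := by cases a <;> rfl

theorem allFail_cons (a : Arm) (h : List Arm) : allFail (a :: h) = failEvent a :: allFail h := by
  cases a <;> rfl

@[simp] theorem allFail_length (h : List Arm) : (allFail h).length = h.length := by
  induction h with
  | nil => rfl
  | cons a h ih => simp [allFail_cons, ih]

theorem success_mem_of_view {i : Player} {f : List Event}
    (h : Signal.own .success ∈ view i f) : Event.success ∈ f := by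
  induction f with
  | nil => simp [view] at h
  | cons e f ih =>
    rw [view] at h
    rcases List.mem_cons.1 h with h1 | h1
    · split_ifs at h1
      rw [Signal.own.injEq] at h1
      simp [h1]
    · exact List.mem_cons_of_mem _ (ih h1)

/-- A player without a success is uncertain only about the successes of the other one, and any such
success puts the other one among those who always choose `R`. -/
theorem eq_allFail_or_success {i j : Player} (hij : j ≠ i) {h : List Arm} {f : List Event}
    (hv : view i f = view i (allFail h)) : f = allFail h ∨ Signal.own .success ∈ view j f := by
  induction h generalizing f with
  | nil =>
    left
    have : f.length = 0 := by rw [← view_length i f, hv]; simp [allFail]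
    simpa [allFail] using this
  | cons a h ih =>
    cases f with
    | nil => simp [allFail_cons, view] at hv
    | cons e f =>
      rw [allFail_cons, view, view, List.cons.injEq] at hv
      obtain ⟨h1, h2⟩ := hv
      have hl : f.length = (allFail h).length := by
        rw [← view_length i f, h2, view_length]
      rcases ih h2 with rfl | h3
      · by_cases hm : mover (allFail h).length = i
        · rw [if_pos hm, if_pos hm, Signal.own.injEq] at h1
          left
          rw [allFail_cons, h1]
        · have hj : mover (allFail h).length = j := by
            generalize mover (allFail h).length = k at *
            cases i <;> cases j <;> cases k <;> simp_all
          rw [if_neg hm, if_neg hm, Signal.other.injEq, arm_failEvent] at h1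
          cases e
          · left; rw [allFail_cons, ← h1]; rfl
          · left; rw [allFail_cons, ← h1]; rfl
          · right; rw [view, if_pos hj]; exact List.mem_cons_self
      · right
        rw [view]
        exact List.mem_cons_of_mem _ h3

theorem view_cons_of_arm_eq {j : Player} {f : List Event} (hf : mover f.length ≠ j) {e e' : Event}
    (h : e.arm = e'.arm) : view j (e :: f) = view j (e' :: f) := by
  simp [view, hf, h]

theorem iterate_phi {lam p : ℝ} (hlam : lam ∈ Set.Ioo (0 : ℝ) 1) (hp : p ∈ Set.Ioo (0 : ℝ) 1)
    (n : ℕ) : (phi lam)^[n] p = p * (1 - lam) ^ n / (p * (1 - lam) ^ n + (1 - p)) := by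
  induction n with
  | zero => simp
  | succ n ih =>
    have h1 : 0 < p * (1 - lam) ^ n := mul_pos hp.1 (pow_pos (by linarith [hlam.2]) _)
    have h2 : 0 < 1 - p := by linarith [hp.2]
    have h3 : 0 < 1 - lam := by linarith [hlam.2]
    rw [Function.iterate_succ_apply', ih, phi, pow_succ, ← mul_assoc]
    set x := p * (1 - lam) ^ n
    have h4 : x / (x + (1 - p)) * (1 - lam) + 1 - x / (x + (1 - p)) =
        (x * (1 - lam) + (1 - p)) / (x + (1 - p)) := by
      field_simp
      ring
    rw [h4]
    field_simp

namespace Game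

variable {Γ : Game} {σ : Profile} {π : Beliefs}

theorem Consistent.badBelief_eq_zero (hcon : Γ.Consistent σ π) {i : Player} {f : List Event}
    (hs : Signal.own .success ∈ view i f) : badBelief π i (view i f) = 0 :=
  Finset.sum_eq_zero fun f' hf' => hcon.bad_eq_zero i f
    (success_mem_of_view (by rw [mem_consistentWith.1 hf']; exact hs))

theorem Consistent.badBelief_allFail (hcon : Γ.Consistent σ π) (i : Player) (h : List Arm) :
    badBelief π i (view i (Bandit.allFail h)) = π i (view i (Bandit.allFail h)) .B
      (Bandit.allFail h) := by
  obtain ⟨j, hj⟩ : ∃ j, j ≠ i := by cases i; exacts [⟨.two, by simp⟩, ⟨.one, by simp⟩]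
  refine Finset.sum_eq_single _ (fun f hf hne => ?_)
    fun hf => absurd (mem_consistentWith.2 rfl) hf
  exact hcon.bad_eq_zero i _ (success_mem_of_view
    ((eq_allFail_or_success hj (mem_consistentWith.1 hf)).resolve_left hne))

theorem sum_moveProb_arm (σ : Profile) (θ : State) (f : List Event) (y : Arm) :
    (∑ e : Event, if e.arm = y then Γ.moveProb σ θ f e else 0) = if y = .S then
      1 - (σ (mover f.length) (view (mover f.length) f) : ℝ) else
      (σ (mover f.length) (view (mover f.length) f) : ℝ) := by
  rw [sum_event]
  cases y <;> simp [Event.arm, moveProb]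
  ring

open Classical in
/-- The choice after a public history by an active player whose experiments have failed. -/
def _root_.Bandit.failAct (σ : Profile) (h : List Arm) : Arm :=
  if σ (mover h.length) (view (mover h.length) (allFail h)) = 0 then .S else .R

/-- The private history of the active player after a public history and own failures. -/
def _root_.Bandit.failView (h : List Arm) : List Signal := view (mover h.length) (allFail h)

/-- The probability that the active player assigns to the bad state after own failures. -/
def _root_.Bandit.failBad (π : Beliefs) (h : List Arm) : ℝ :=
  badBelief π (mover h.length) (failView h)

/-- The value of the active player after own failures. -/
def failValue (Γ : Game) (σ : Profile) (π : Beliefs) (h : List Arm) : ℝ :=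
  Γ.contPayoff π σ (mover h.length) (failView h)

/-- The probability of a reply of the other player after own failures and an own event. -/
def failReach (Γ : Game) (σ : Profile) (π : Beliefs) (h : List Arm) (e : Event) (y : Arm) : ℝ :=
  Γ.reach σ (π (mover h.length) (failView h)) (mover h.length) (failView h) e y

namespace PureEquilibrium

theorem failAct_cases (E : PureEquilibrium Γ σ π) (h : List Arm) :
    (failAct σ h = .S ∧ σ (mover h.length) (view (mover h.length) (allFail h)) = 0) ∨
      (failAct σ h = .R ∧ σ (mover h.length) (view (mover h.length) (allFail h)) = 1) := by
  have := E.isPure (allFail h)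
  rw [allFail_length] at this
  rcases this with h0 | h1
  · exact .inl ⟨by simp [failAct, h0], h0⟩
  · exact .inr ⟨by simp [failAct, h1], h1⟩

/-- The reply of the other player to an own event. -/
theorem reply (E : PureEquilibrium Γ σ π) {h : List Arm} {f : List Event}
    (hf : view (mover h.length) f = view (mover h.length) (allFail h)) (e : Event) :
    σ (mover (e :: f).length) (view (mover (e :: f).length) (e :: f)) =
      if f = allFail h ∧ failAct σ (e.arm :: h) = .S then 0 else 1 := by
  have hlen : f.length = h.length := by rw [← view_length (mover h.length) f, hf]; simp
  have hne : mover (h.length + 1) ≠ mover h.length := mover_succ_ne _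
  simp only [List.length_cons, hlen]
  by_cases hfa : f = allFail h
  · subst hfa
    have hv : view (mover (h.length + 1)) (e :: allFail h) =
        view (mover (h.length + 1)) (allFail (e.arm :: h)) := by
      rw [allFail_cons]
      exact view_cons_of_arm_eq (by rw [allFail_length]; exact hne.symm) (by simp)
    rw [hv]
    rcases E.failAct_cases (e.arm :: h) with ⟨h1, h2⟩ | ⟨h1, h2⟩
    · simp only [List.length_cons] at h2
      simp [h1, h2]
    · simp only [List.length_cons] at h2
      simp [h1, h2]
  · rw [if_neg fun hc => hfa hc.1]
    have hs := (eq_allFail_or_success hne hf).resolve_left hfa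
    refine E.eq_one_of_bad_eq_zero (by simp [hlen]) (E.consistent.badBelief_eq_zero ?_)
    rw [view]
    exact List.mem_cons_of_mem _ hs

theorem failReach_safe_of_pool (E : PureEquilibrium Γ σ π) {h : List Arm} {e : Event}
    (ha : failAct σ (e.arm :: h) = .R) : Γ.failReach σ π h e .S = 0 := by
  rw [failReach, reach]
  refine Finset.sum_eq_zero fun θ _ => Finset.sum_eq_zero fun f hf => ?_
  rw [sum_moveProb_arm, if_pos rfl, E.reply (mem_consistentWith.1 hf), ha]
  simp

theorem failReach_safe_of_sep (E : PureEquilibrium Γ σ π) {h : List Arm} {e : Event}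
    (ha : failAct σ (e.arm :: h) = .S) : Γ.failReach σ π h e .S =
      π (mover h.length) (failView h) .G (allFail h) * Γ.outProb .G e +
      failBad π h * Γ.outProb .B e := by
  rw [failBad, failView, E.consistent.badBelief_allFail, failReach, reach, sum_state]
  congr 1
  all_goals
    refine (Finset.sum_eq_single (allFail h) ?_ ?_).trans ?_
    rotate_left 2
    · rw [sum_moveProb_arm, if_pos rfl, E.reply rfl, if_pos ⟨rfl, ha⟩]
      simp [failView]
    · intro f hf hne
      rw [sum_moveProb_arm, if_pos rfl, E.reply (mem_consistentWith.1 hf),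
        if_neg fun hc => hne hc.1]
      simp
    · exact fun hf => absurd (mem_consistentWith.2 rfl) hf

theorem goodBelief_failView (E : PureEquilibrium Γ σ π) (h : List Arm) :
    goodBelief π (mover h.length) (failView h) = 1 - failBad π h :=
  eq_sub_of_add_eq (E.beliefs.add_eq_one (mover h.length) (allFail h))

theorem failReach_add (E : PureEquilibrium Γ σ π) (h : List Arm) (e : Event) :
    Γ.failReach σ π h e .S + Γ.failReach σ π h e .R =
      (1 - failBad π h) * Γ.outProb .G e + failBad π h * Γ.outProb .B e := by
  have h1 := reach_add (Γ := Γ) (σ := σ) (π := π) (mover h.length) (failView h) e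
  rwa [E.goodBelief_failView] at h1

theorem failBad_nonneg (E : PureEquilibrium Γ σ π) (h : List Arm) : 0 ≤ failBad π h :=
  E.beliefs.bad_nonneg _ _

/-- The weight of the histories without successes in the good state. -/
theorem good_allFail (E : PureEquilibrium Γ σ π) (h : List Arm) :
    π (mover h.length) (failView h) .G (allFail h) =
      failBad π h * (Γ.p0 / (1 - Γ.p0) * (1 - Γ.lam) ^ numExp h) := by
  have h1 := E.consistent.allFail (mover h.length) h
  rw [failBad, failView, E.consistent.badBelief_allFail]
  have : 1 - Γ.p0 ≠ 0 := by linarith [E.hp.2]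
  rw [← mul_right_inj' this]
  field_simp
  linarith

theorem good_allFail_le (E : PureEquilibrium Γ σ π) (h : List Arm) :
    failBad π h * (Γ.p0 / (1 - Γ.p0) * (1 - Γ.lam) ^ numExp h) ≤ 1 - failBad π h := by
  rw [← E.good_allFail]
  have h3 := E.goodBelief_failView h
  rw [← h3]
  exact Finset.single_le_sum (f := fun f => π (mover h.length) (failView h) .G f)
    (fun f _ => (E.beliefs (mover h.length) (allFail h)).1 .G f) (mem_consistentWith.2 rfl)

theorem failView_cons (y x : Arm) (h : List Arm) :
    failView (y :: x :: h) = .other y :: .own (failEvent x) :: failView h := by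
  have hm : mover (y :: x :: h).length = mover h.length := mover_add_two h.length
  rw [failView, hm, allFail_cons, allFail_cons, view_period (by rw [allFail_length]),
    arm_failEvent]
  rfl

/-- In the bad state the path is the one of failures only, and the reply along it is deterministic.
This identity is what makes transition probabilities cancel after normalization by `failBad`. -/
theorem failReach_mul_failBad (E : PureEquilibrium Γ σ π) (h : List Arm) (x y : Arm) :
    Γ.failReach σ π h (failEvent x) y * failBad π (y :: x :: h) =
      if failAct σ (x :: h) = y then failBad π h else 0 := by
  have hm : mover (y :: x :: h).length = mover h.length := mover_add_two h.length
  have h1 := E.consistent.step E.hlam E.hp (i := mover h.length) (f := allFail h)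
    (by rw [allFail_length]) .B (failEvent x) (failEvent y)
  have h2 : failBad π (y :: x :: h) = π (mover h.length)
      (.other y :: .own (failEvent x) :: failView h) .B
      (failEvent y :: failEvent x :: allFail h) := by
    rw [failBad, failView, E.consistent.badBelief_allFail, hm, allFail_cons, allFail_cons,
      view_period (by rw [allFail_length]), arm_failEvent]
    rfl
  have h3 : failBad π h = π (mover h.length) (failView h) .B (allFail h) := by
    rw [failBad, failView, E.consistent.badBelief_allFail]
  rw [arm_failEvent] at h1
  rw [h2, h3]
  refine h1.trans ?_
  have h4 : Γ.outProb .B (failEvent x) = 1 := by cases x <;> simp [failEvent, outProb, succProb]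
  rw [h4, mul_one, moveProb_eq, E.reply rfl, arm_failEvent]
  rcases E.failAct_cases (x :: h) with ⟨ha, -⟩ | ⟨ha, -⟩ <;> cases y <;>
    simp [ha, failEvent, actProb, outProb, succProb, failView]

theorem failValue_of_failBad_eq_zero (E : PureEquilibrium Γ σ π) {h : List Arm}
    (hb : failBad π h = 0) : Γ.failValue σ π h = Γ.g :=
  E.contPayoff_eq_gain (by rw [allFail_length]) hb

theorem failAct_of_failBad_eq_zero (E : PureEquilibrium Γ σ π) {h : List Arm}
    (hb : failBad π h = 0) : failAct σ h = .R := by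
  have := E.eq_one_of_bad_eq_zero (f := allFail h) (by rw [allFail_length]) hb
  simp [failAct, this]

theorem afterEvent_success (E : PureEquilibrium Γ σ π) (h : List Arm) :
    Γ.afterEvent σ π (mover h.length) (failView h) .success =
      (1 - failBad π h) * Γ.lam * Γ.g := by
  have hv : ∀ e' : Event, Γ.contPayoff π σ (mover h.length)
      (.other e'.arm :: .own .success :: failView h) = Γ.g := by
    intro e'
    have h1 := view_period (i := mover h.length) (f := allFail h) (by rw [allFail_length])
      .success e'
    have h2 := E.contPayoff_eq_gain (i := mover h.length) (f := e' :: .success :: allFail h)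
      (by simpa using mover_add_two h.length)
      (E.consistent.badBelief_eq_zero (by rw [h1]; simp))
    rwa [h1] at h2
  have hS := hv .safe
  have hR := hv .fail
  have hadd := E.failReach_add h .success
  simp only [outProb, succProb, mul_zero, add_zero] at hadd
  rw [afterEvent, show Arm.S = Event.safe.arm from rfl, show Arm.R = Event.fail.arm from rfl,
    hS, hR, ← hadd, add_mul]
  rfl

theorem afterEvent_eq (h : List Arm) (x : Arm) :
    Γ.afterEvent σ π (mover h.length) (failView h) (failEvent x) =
      Γ.failReach σ π h (failEvent x) .S * Γ.failValue σ π (.S :: x :: h) +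
      Γ.failReach σ π h (failEvent x) .R * Γ.failValue σ π (.R :: x :: h) := by
  have hm : ∀ y, mover (y :: x :: h).length = mover h.length := fun y => mover_add_two h.length
  rw [failValue, failValue, failView_cons, failView_cons, hm, hm]
  rfl

theorem outProb_failEvent (Γ : Game) (x : Arm) :
    Γ.outProb .G (failEvent x) = (1 - Γ.lam) ^ numExp [x] ∧ Γ.outProb .B (failEvent x) = 1 := by
  cases x
  · simp [failEvent, outProb]
  · simp [failEvent, outProb, succProb]

/-- The odds of the good state after a public history and own failures. -/
def _root_.Bandit.failOdds (π : Beliefs) (h : List Arm) : ℝ := (1 - failBad π h) / failBad π h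

/-- The normalized value after a public history and own failures. -/
def _root_.Bandit.Game.normValue (Γ : Game) (σ : Profile) (π : Beliefs) (h : List Arm) : ℝ :=
  Γ.failValue σ π h / (failBad π h * Γ.g)

/-- Under separation, `S` leads to an opponent without a success, while the weight of `R` is exactly
that of his having had one. Under pooling only `R` occurs. -/
theorem afterEvent_div (E : PureEquilibrium Γ σ π) {h : List Arm} (hb : 0 < failBad π h)
    (x : Arm) :
    Γ.afterEvent σ π (mover h.length) (failView h) (failEvent x) / (failBad π h * Γ.g) =
      if failAct σ (x :: h) = .S then Γ.normValue σ π (.S :: x :: h) + (1 - Γ.lam) ^ numExp [x] *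
        (failOdds π h - Γ.p0 / (1 - Γ.p0) * (1 - Γ.lam) ^ numExp h)
      else Γ.normValue σ π (.R :: x :: h) := by
  have hg := E.hg
  have hS := E.failReach_mul_failBad h x .S
  have hR := E.failReach_mul_failBad h x .R
  have hadd := E.failReach_add h (failEvent x)
  have key : ∀ y, Γ.failReach σ π h (failEvent x) y * failBad π (y :: x :: h) = failBad π h →
      Γ.failReach σ π h (failEvent x) y * Γ.failValue σ π (y :: x :: h) / (failBad π h * Γ.g) =
        Γ.normValue σ π (y :: x :: h) := by
    intro y hy
    have h1 : Γ.failReach σ π h (failEvent x) y ≠ 0 := fun h0 => by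
      rw [h0, zero_mul] at hy; exact hb.ne hy
    have h2 : failBad π (y :: x :: h) ≠ 0 := fun h0 => by
      rw [h0, mul_zero] at hy; exact hb.ne hy
    rw [normValue, ← hy]
    field_simp
  rw [afterEvent_eq]
  rcases E.failAct_cases (x :: h) with ⟨ha, -⟩ | ⟨ha, -⟩
  · rw [if_pos ha] at hS ⊢
    rw [ha, if_neg (by simp)] at hR
    have hs := E.failReach_safe_of_sep (h := h) (e := failEvent x) (by rwa [arm_failEvent])
    -- Either the reply `R` has probability zero, or it excludes the bad state and the value is `g`.
    have hV : Γ.failReach σ π h (failEvent x) .R * Γ.failValue σ π (.R :: x :: h) =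
        Γ.failReach σ π h (failEvent x) .R * Γ.g := by
      rcases mul_eq_zero.1 hR with h0 | h0
      · rw [h0, zero_mul, zero_mul]
      · rw [E.failValue_of_failBad_eq_zero h0]
    rw [hs] at hadd
    obtain ⟨h5, h6⟩ := outProb_failEvent Γ x
    rw [E.good_allFail, h5, h6] at hadd
    rw [add_div, key _ hS, hV]
    congr 1
    rw [eq_sub_of_add_eq' hadd, failOdds]
    field_simp
    ring
  · rw [ha, if_pos rfl] at hR
    rw [if_neg (by simp [ha]), E.failReach_safe_of_pool (by rwa [arm_failEvent]), zero_mul,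
      zero_add, key _ hR]

theorem safePayoff_div (E : PureEquilibrium Γ σ π) {h : List Arm} (hb : 0 < failBad π h) :
    Γ.safePayoff σ π (mover h.length) (failView h) / (failBad π h * Γ.g) =
      Γ.δ * (if failAct σ (.S :: h) = .S then Γ.normValue σ π (.S :: .S :: h) +
        (failOdds π h - Γ.p0 / (1 - Γ.p0) * (1 - Γ.lam) ^ numExp h)
      else Γ.normValue σ π (.R :: .S :: h)) := by
  have := E.afterEvent_div hb .S
  rw [show numExp [Arm.S] = 0 from rfl, pow_zero, one_mul] at this
  rw [← this, safePayoff, mul_div_assoc]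
  rfl

theorem riskyPayoff_div (E : PureEquilibrium Γ σ π) {h : List Arm} (hb : 0 < failBad π h) :
    Γ.riskyPayoff σ π (mover h.length) (failView h) / (failBad π h * Γ.g) =
      failOdds π h * (1 - Γ.δ) - (1 - Γ.δ) * Γ.c / Γ.g + Γ.δ * (failOdds π h * Γ.lam +
      (if failAct σ (.R :: h) = .S then Γ.normValue σ π (.S :: .R :: h) +
        (1 - Γ.lam) * (failOdds π h - Γ.p0 / (1 - Γ.p0) * (1 - Γ.lam) ^ numExp h)
      else Γ.normValue σ π (.R :: .R :: h))) := by
  have hg := E.hg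
  have h1 := E.afterEvent_div hb .R
  rw [show numExp [Arm.R] = 1 from rfl, pow_one] at h1
  rw [← h1, riskyPayoff, E.afterEvent_success]
  have h3 := E.goodBelief_failView h
  have h4 : badBelief π (mover h.length) (failView h) = failBad π h := rfl
  rw [h3, h4, failOdds]
  simp only [failEvent]
  field_simp
  ring

theorem failBad_of_belief (E : PureEquilibrium Γ σ π) {h : List Arm} {n : ℕ}
    (hb : firstOrderBelief π (mover h.length) h = (phi Γ.lam)^[n] Γ.p0) :
    0 < failBad π h ∧ failOdds π h = Γ.p0 / (1 - Γ.p0) * (1 - Γ.lam) ^ n := by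
  have h3 : firstOrderBelief π (mover h.length) h = 1 - failBad π h := E.goodBelief_failView h
  rw [h3, iterate_phi E.hlam E.hp] at hb
  have h4 : 0 < Γ.p0 * (1 - Γ.lam) ^ n := mul_pos E.hp.1 (pow_pos (by linarith [E.hlam.2]) _)
  have h5 : 0 < 1 - Γ.p0 := by linarith [E.hp.2]
  have h6 : failBad π h = (1 - Γ.p0) / (Γ.p0 * (1 - Γ.lam) ^ n + (1 - Γ.p0)) := by
    rw [eq_div_iff (by positivity)]
    rw [eq_div_iff (by positivity)] at hb
    linarith
  refine ⟨by rw [h6]; positivity, ?_⟩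
  rw [failOdds, hb, h6]
  field_simp

theorem le_normValue (E : PureEquilibrium Γ σ π) {h : List Arm} (hb : 0 < failBad π h) {x : ℝ}
    (hx : x ≤ Γ.failValue σ π h) : x / (failBad π h * Γ.g) ≤ Γ.normValue σ π h :=
  div_le_div_of_nonneg_right hx (mul_pos hb E.hg).le

/-- The reduced equilibrium. -/
def reduced (E : PureEquilibrium Γ σ π) :
    Reduced Γ.lam Γ.δ ((1 - Γ.δ) * Γ.c / Γ.g) (Γ.p0 / (1 - Γ.p0)) where
  act := failAct σ
  good h := 0 < failBad π h
  odds := failOdds π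
  val := Γ.normValue σ π
  good_safe h := (E.failBad_of_belief (E.isReasonable.2.1 h)).1
  odds_safe h := (E.failBad_of_belief (E.isReasonable.2.1 h)).2
  good_fresh h a := (E.failBad_of_belief (E.isReasonable.2.2 h a)).1
  odds_fresh h a := by
    rw [(E.failBad_of_belief (E.isReasonable.2.2 h a)).2]
    cases a <;> simp
  good_pool h x hb ha := by
    have h1 := E.failReach_mul_failBad h x .R
    rw [if_pos ha] at h1
    exact (E.failBad_nonneg _).lt_of_ne fun h0 => by
      rw [← h0, mul_zero] at h1; exact hb.ne h1
  odds_pool h x hb ha := by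
    have h1 := E.failReach_mul_failBad h x .R
    rw [if_pos ha] at h1
    have h2 := E.failReach_add h (failEvent x)
    rw [E.failReach_safe_of_pool (by rwa [arm_failEvent]), (outProb_failEvent Γ x).1,
      (outProb_failEvent Γ x).2, zero_add] at h2
    have h3 : failBad π (.R :: x :: h) ≠ 0 := fun h0 => by
      rw [h0, mul_zero] at h1; exact hb.ne h1
    have hb' := hb.ne'
    rw [h2] at h1
    rw [failOdds, failOdds]
    field_simp
    linear_combination -h1
  act_revealed h x hb hr ha := by
    have h1 := E.failReach_mul_failBad h x .R
    rw [ha, if_neg (by simp)] at h1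
    have h2 := E.failReach_add h (failEvent x)
    rw [E.failReach_safe_of_sep (by rwa [arm_failEvent]), E.good_allFail,
      (outProb_failEvent Γ x).1, (outProb_failEvent Γ x).2] at h2
    -- It remains to see that the revealing `R` has positive probability, which is what the strict
    -- inequality of odds gives.
    refine E.failAct_of_failBad_eq_zero ((mul_eq_zero.1 h1).resolve_left fun h0 => ?_)
    rw [h0] at h2
    rw [failOdds, lt_div_iff₀ hb] at hr
    have h3 : 0 < (1 - Γ.lam) ^ numExp [x] := pow_pos (by linarith [E.hlam.2]) _
    have := mul_lt_mul_of_pos_right hr h3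
    linarith
  le_odds h hb := by
    rw [failOdds, le_div_iff₀ hb]
    have := E.good_allFail_le h
    linarith
  val_nonneg h hb := by
    have := E.le_normValue hb (E.contPayoff_nonneg (by rw [allFail_length]))
    rwa [zero_div] at this
  val_le h hb := by
    have hg := E.hg
    have h3 := E.goodBelief_failView h
    have h4 := contPayoff_le (σ := σ) E.hlam E.hδ E.hc E.hg E.beliefs (mover h.length) (allFail h)
    have h5 : Γ.failValue σ π h ≤ (1 - failBad π h) * Γ.g := by rw [← h3]; exact h4
    rw [normValue, failOdds, ← mul_div_mul_right (1 - failBad π h) _ hg.ne']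
    exact div_le_div_of_nonneg_right h5 (mul_pos hb hg).le
  safe_le h hb := by
    rw [← E.safePayoff_div hb]
    exact E.le_normValue hb (E.safePayoff_le (by rw [allFail_length]))
  risky_le h hb := by
    rw [← E.riskyPayoff_div hb]
    exact E.le_normValue hb (E.riskyPayoff_le (by rw [allFail_length]))
  val_safe h hb ha := by
    have h1 := E.contPayoff_eq (f := allFail h) (i := mover h.length) (by rw [allFail_length])
    rcases E.failAct_cases h with ⟨-, h2⟩ | ⟨h2, -⟩
    · rw [h2] at h1
      rw [← E.safePayoff_div hb, normValue]
      congr 1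
      rw [Set.Icc.coe_zero, sub_zero, one_mul, zero_mul, add_zero] at h1
      exact h1
    · rw [ha] at h2; cases h2
  val_risky h hb ha := by
    have h1 := E.contPayoff_eq (f := allFail h) (i := mover h.length) (by rw [allFail_length])
    rcases E.failAct_cases h with ⟨h2, -⟩ | ⟨-, h2⟩
    · rw [ha] at h2; cases h2
    · rw [h2] at h1
      rw [← E.riskyPayoff_div hb, normValue]
      congr 1
      rw [Set.Icc.coe_one, sub_self, zero_mul, one_mul, zero_add] at h1
      exact h1

end PureEquilibrium
end Game
end
end Bandit

theorem mainTheorem6 (Γ : Bandit.Game)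
    (hlam : Γ.lam ∈ Set.Ioo (0 : ℝ) 1) (hδ : Γ.δ ∈ Set.Ioo (0 : ℝ) 1)
    (hc : 0 < Γ.c) (hg : 0 < Γ.g)
    (hcut : Bandit.phiInv Γ.lam Γ.pHat < Γ.pStar)
    (hp0 : Γ.p0 ∈ Set.Ioo (Bandit.phiInv Γ.lam Γ.pHat) (Γ.pStarN 1)) :
    ¬ ∃ (σ : Bandit.Profile) (π : Bandit.Beliefs), Γ.IsReasonableSE σ π ∧ Bandit.IsPure σ := by
  rintro ⟨σ, π, hSE, hpure⟩
  obtain ⟨hl0, hl1⟩ := hlam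
  obtain ⟨hd0, hd1⟩ := hδ
  obtain ⟨hp1, hp2⟩ := hp0
  set A := 1 - Γ.δ + Γ.lam * Γ.δ * (1 + Γ.δ - Γ.lam * Γ.δ) with hA
  have hApos : 0 < A := by
    have : 0 < Γ.lam * Γ.δ * (1 + Γ.δ - Γ.lam * Γ.δ) :=
      mul_pos (mul_pos hl0 hd0) (by nlinarith)
    linarith
  have hBpos : 0 < 1 - Γ.δ + Γ.δ * Γ.lam * (1 - Γ.lam) := by
    have : 0 < Γ.δ * Γ.lam * (1 - Γ.lam) := mul_pos (mul_pos hd0 hl0) (by linarith)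
    linarith
  have hk : 0 < Γ.c * (1 - Γ.δ) := mul_pos hc (by linarith)
  have hq : 1 - Γ.lam ≠ 0 := by linarith
  have hq' : 0 < 1 - Γ.lam := by linarith
  have hphi : Bandit.phiInv Γ.lam Γ.pHat =
      Γ.c * (1 - Γ.δ) / (Γ.c * (1 - Γ.δ) + Γ.g * A * (1 - Γ.lam)) := by
    rw [Bandit.phiInv, Bandit.Game.pHat, ← hA]
    have h1 : 1 - Γ.c * (1 - Γ.δ) / (Γ.c * (1 - Γ.δ) + Γ.g * A) =
        Γ.g * A / (Γ.c * (1 - Γ.δ) + Γ.g * A) := by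
      field_simp
      ring
    rw [h1]
    field_simp
  rw [hphi, div_lt_iff₀ (by positivity)] at hp1
  rw [Bandit.Game.pStarN, pow_one, lt_div_iff₀ (by positivity)] at hp2
  -- That the prior lies strictly between `0` and `1` follows from its position between the
  -- cut-offs.
  have hpos : 0 < Γ.p0 := by
    by_contra hle
    have : Γ.p0 * (Γ.c * (1 - Γ.δ) + Γ.g * A * (1 - Γ.lam)) ≤ 0 :=
      mul_nonpos_of_nonpos_of_nonneg (not_lt.1 hle) (by positivity)
    linarith
  have hlt1 : Γ.p0 < 1 := by
    by_contra hge
    have := mul_le_mul_of_nonneg_right (not_lt.1 hge) hk.le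
    have : 0 < Γ.p0 * (Γ.g * (1 - Γ.δ + Γ.δ * Γ.lam * (1 - Γ.lam))) := by positivity
    linarith
  have hr : 0 < 1 - Γ.p0 := by linarith
  have E : Bandit.Game.PureEquilibrium Γ σ π :=
    ⟨⟨hl0, hl1⟩, ⟨hd0, hd1⟩, hc, hg, ⟨hpos, hlt1⟩, hSE, hpure⟩
  -- Cleared of denominators, the two bounds on the prior are the two inequalities on the odds.
  refine E.reduced.false_of_cutoffs ⟨hl0, hl1⟩ ⟨hd0, hd1⟩ (div_pos hpos hr)
    (div_pos (by linarith) hg) ?_ ?_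
  · rw [← hA, div_lt_iff₀ hg, div_mul_eq_mul_div, div_mul_eq_mul_div, div_mul_eq_mul_div,
      lt_div_iff₀ hr]
    linarith
  · rw [lt_div_iff₀ hg, div_mul_eq_mul_div, div_mul_eq_mul_div, div_lt_iff₀ hr]
    linarith
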